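/- Let $k,l$ be positive integers. Let $\mathrm{Fr}_{k,l}=\mathrm{Hom}_{alg}(M_k(\mathbb C),M_{kl}(\mathbb C))$ be the space of unital $*$-homomorphisms, and let $\widetilde{\mathcal B}_{k,l}\to \mathrm{Fr}_{k,l}$ be the bundle of centralizers, i.e. the subbundle of $\mathrm{Fr}_{k,l}\times M_{kl}(\mathbb C)$ whose fiber at $h$ is the centralizer of $h(M_k(\mathbb C))$ in $M_{kl}(\mathbb C)$. An $M_l(\mathbb C)$-bundle is a locally trivial bundle of $*$-algebras with fiber $M_l(\mathbb C)$ (structure group $\mathrm{PU}(l)=\mathrm{Aut}(M_l(\mathbb C))$), isomorphisms of such bundles are $*$-isomorphisms on the fibers, and a classifying map of an $M_l(\mathbb C)$-bundle over $X$ is a map $X\to \mathrm{BPU}(l)$ that is covered by a morphism of principal $\mathrm{PU}(l)$-bundles from its bundle of frames to the universal bundle $\mathrm{EPU}(l)\to\mathrm{BPU}(l)$ (in Milnor's model). Then $\widetilde{\mathcal B}_{k,l}$ is an $M_l(\mathbb C)$-bundle and has a classifying map; denote by $\psi'_k:\mathrm{Fr}_{k,l}\to\mathrm{BPU}(l)$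 any such map. Let $X$ be a topological space, $[M_k]$ the trivial $M_k(\mathbb C)$-bundle over $X$, and $B_l\to X$ an $M_l(\mathbb C)$-bundle. (1) If $[M_k]\otimes B_l\cong X\times M_{kl}(\mathbb C)$, then $B_l$ has a classifying map, and there is a continuous map $\widetilde\varphi_{B_l}:X\to \mathrm{Fr}_{k,l}$ such that $B_l\cong\widetilde\varphi_{B_l}^*(\widetilde{\mathcal B}_{k,l})$, the map $\psi'_k\circ\widetilde\varphi_{B_l}$ is a classifying map of $B_l$, and $\psi'_k\circ\widetilde\varphi_{B_l}\simeq\varphi_{B_l}$ for every classifying map $\varphi_{B_l}:X\to\mathrm{BPU}(l)$ of $B_l$. (2) The choice of the lift corresponds to the choice of the trivialization: the equations $\theta_x(T\otimes 1)=f(x)(T)$ and $\theta_x(1\otimes b)=\alpha_x(b)$ (for $x\in X$, $T\in M_k(\mathbb C)$, $b\in (B_l)_x$) define a bijection between the isomorphisms $\theta:[M_k]\otimes B_l\to X\times M_{kl}(\mathbb C)$ and the pairs $(f,\alpha)$ of a continuous map $f:X\to \mathrm{Fr}_{k,l}$ and an isomorphism $\alpha:B_l\to f^*(\widetilde{\mathcal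 B}_{k,l})$. For a continuous map $f:X\to\mathrm{Fr}_{k,l}$, the composite $\psi'_k\circ f$ is a classifying map of $B_l$ if and only if there is such a $\theta$ with $\theta_x(T\otimes 1)=f(x)(T)$ for all $x$ and $T$. (3) A map $X\to\mathrm{Fr}_{k,l}$ is the same thing as an $M_l(\mathbb C)$-bundle over $X$ together with such a trivialization, up to isomorphism: for every continuous $f:X\to\mathrm{Fr}_{k,l}$, $f^*(\widetilde{\mathcal B}_{k,l})$ is an $M_l(\mathbb C)$-bundle and has a trivialization $\theta$ with $\theta_x(T\otimes 1)=f(x)(T)$; and if $(B,\theta)$ is a pair of an $M_l(\mathbb C)$-bundle $B$ over $X$ and an isomorphism $\theta:[M_k]\otimes B\to X\times M_{kl}(\mathbb C)$ that gives $f$ in this way, then another such pair $(B',\theta')$ gives the same $f$ if and only if there is an isomorphism $\beta:B\to B'$ with $\theta'_x(T\otimes\beta_x(b))=\theta_x(T\otimes b)$ for all $x\in X$, $T\in M_k(\mathbb C)$, $b\in B_x$. -/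

import Mathlib

open scoped TensorProduct

universe u v w

noncomputable section

/-- The `*`-algebra `M_n(ℂ)` (with its usual topology, the entrywise one). -/
abbrev Mat (n : ℕ) : Type := Matrix (Fin n) (Fin n) ℂ

/-! ### Bundles of `*`-algebras -/

/-- A family of unital complex `*`-algebras over `X`, with a topology on its total space.
Local triviality is the separate predicate `StarAlgBundle.IsMatrixBundle`. -/
structure StarAlgBundle (X : Type u) where
  /-- the fibers -/
  Fiber : X → Type v
  [ring : ∀ x, Ring (Fiber x)]
  [starRing : ∀ x, StarRing (Fiber x)]
  [algebra : ∀ x, Algebra ℂ (Fiber x)]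
  [starModule : ∀ x, StarModule ℂ (Fiber x)]
  /-- the topology on the total space -/
  top : TopologicalSpace (Bundle.TotalSpace Unit Fiber)

namespace StarAlgBundle

variable {X : Type u}

instance (B : StarAlgBundle.{u, v} X) (x : X) : Ring (B.Fiber x) := B.ring x
instance (B : StarAlgBundle.{u, v} X) (x : X) : StarRing (B.Fiber x) := B.starRing x
instance (B : StarAlgBundle.{u, v} X) (x : X) : Algebra ℂ (B.Fiber x) := B.algebra x
instance (B : StarAlgBundle.{u, v} X) (x : X) : StarModule ℂ (B.Fiber x) := B.starModule x

/-- The total space. -/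
abbrev Total (B : StarAlgBundle.{u, v} X) : Type (max u v) := Bundle.TotalSpace Unit B.Fiber

instance (B : StarAlgBundle.{u, v} X) : TopologicalSpace B.Total := B.top

/-- The bundle projection. -/
def proj (B : StarAlgBundle.{u, v} X) : B.Total → X := fun p => p.proj

/-- `B` is an `M_n(ℂ)`-bundle: it is locally trivial with fiber `M_n(ℂ)`, by local trivializations
which are `*`-isomorphisms on the fibers (structure group `Aut(M_n(ℂ)) = PU(n)`). -/
def IsMatrixBundle [TopologicalSpace X] (n : ℕ) (B : StarAlgBundle.{u, v} X) : Prop :=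
  ∀ x : X, ∃ e : Bundle.Trivialization (Mat n) B.proj, x ∈ e.baseSet ∧
    ∀ y ∈ e.baseSet, ∃ i : B.Fiber y ≃⋆ₐ[ℂ] Mat n, ∀ b : B.Fiber y, (e ⟨y, b⟩).2 = i b

/-- An isomorphism of bundles of `*`-algebras over `X`: a homeomorphism of the total spaces
given by `*`-isomorphisms of the fibers. -/
@[ext]
structure Iso (B : StarAlgBundle.{u, v} X) (C : StarAlgBundle.{u, w} X) where
  /-- the isomorphisms of the fibers -/
  fiber : ∀ x, B.Fiber x ≃⋆ₐ[ℂ] C.Fiber x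
  continuous_toFun : Continuous (fun p : B.Total => (⟨p.1, fiber p.1 p.2⟩ : C.Total))
  continuous_invFun : Continuous (fun p : C.Total => (⟨p.1, (fiber p.1).symm p.2⟩ : B.Total))

/-- The trivial bundle `X × M_n(ℂ)`. -/
def trivial (X : Type u) [TopologicalSpace X] (n : ℕ) : StarAlgBundle.{u, 0} X where
  Fiber := fun _ => Mat n
  top := TopologicalSpace.induced (fun p => ((p.1, p.2) : X × Mat n)) inferInstance

/-- The pullback `f^* B`, with total space `{(x, b) | b ∈ B_{f(x)}} ⊆ X × B`. -/
def pullback {Y : Type w} [TopologicalSpace X] [TopologicalSpace Y] (f : C(X, Y))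
    (B : StarAlgBundle.{w, v} Y) : StarAlgBundle.{u, v} X where
  Fiber := fun x => B.Fiber (f x)
  top := TopologicalSpace.induced (fun p => ((p.1, ⟨f p.1, p.2⟩) : X × B.Total)) inferInstance

/-- The tensor product `[M_k] ⊗ B` with the trivial `M_k(ℂ)`-bundle.  A choice of a basis of
`M_k(ℂ)` identifies it with the Whitney sum of `k²` copies of `B`; its topology is the one of this
Whitney sum, i.e. the coarsest one for which all the coefficient maps
`c ⊗ id : [M_k] ⊗ B → B`, for `c` in the dual space of `M_k(ℂ)`, are continuous. -/
def tensorMatrix (k : ℕ) (B : StarAlgBundle.{u, v} X) : StarAlgBundle.{u, v} X where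
  Fiber := fun x => Mat k ⊗[ℂ] B.Fiber x
  top := ⨅ c : Module.Dual ℂ (Mat k), TopologicalSpace.induced
    (fun p => (⟨p.1, TensorProduct.lid ℂ (B.Fiber p.1) (c.rTensor (B.Fiber p.1) p.2)⟩ : B.Total))
    inferInstance

end StarAlgBundle

/-! ### The space `Fr_{k,l}` and the bundle of centralizers over it -/

/-- `Fr_{k,l} = Hom_alg(M_k(ℂ), M_{kl}(ℂ))`, the space of unital `*`-homomorphisms. -/
abbrev Fr (k l : ℕ) : Type := Mat k →⋆ₐ[ℂ] Mat (k * l)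

/-- The topology of pointwise convergence (on the finite-dimensional space of linear maps
`M_k(ℂ) → M_{kl}(ℂ)` this is the usual one). -/
instance Fr.instTopologicalSpace (k l : ℕ) : TopologicalSpace (Fr k l) :=
  TopologicalSpace.induced (fun h => (h : Mat k → Mat (k * l))) inferInstance

/-- The bundle of centralizers over `Fr_{k,l}`: the subbundle of `Fr_{k,l} × M_{kl}(ℂ)` whose fiber
at `h` is the centralizer of the `k`-subalgebra `h(M_k(ℂ))` in `M_{kl}(ℂ)`. -/
def centralizerBundle (k l : ℕ) : StarAlgBundle.{0, 0} (Fr k l) where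
  Fiber := fun h => StarSubalgebra.centralizer ℂ (Set.range h)
  top := TopologicalSpace.induced
    (fun p => ((p.1, (p.2 : Mat (k * l))) : Fr k l × Mat (k * l))) inferInstance

/-! ### The classifying space of a topological group (Milnor's construction) -/

/-- Milnor's infinite join `G * G * G * ⋯`: its points are the sequences `(t_i, g_i)` of weights
`t_i ≥ 0`, almost all zero and with sum `1`, and elements `g_i` of `G` which are
present exactly if `t_i ≠ 0`. -/
@[ext]
structure MilnorE (G : Type u) where
  /-- the weights -/
  t : ℕ →₀ ℝ
  /-- the group elements -/
  g : ℕ → Option G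
  nonneg : ∀ i, 0 ≤ t i
  sum_eq_one : (t.sum fun _ r => r) = 1
  g_eq_none_iff : ∀ i, g i = none ↔ t i = 0

/-- Milnor's topology: the coarsest one for which all the functions `t_i : EG → ℝ` and
`g_i : {t_i ≠ 0} → G` are continuous. -/
instance MilnorE.instTopologicalSpace (G : Type u) [TopologicalSpace G] :
    TopologicalSpace (MilnorE G) :=
  (⨅ i : ℕ, TopologicalSpace.induced (fun e => e.t i) inferInstance) ⊓
    TopologicalSpace.generateFrom
      {S | ∃ (i : ℕ) (V : Set G), IsOpen V ∧ S = {e | ∃ a ∈ V, e.g i = some a}}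

/-- The free action of `G` on `EG` by translation of all the group elements. -/
instance MilnorE.instMulAction (G : Type u) [Group G] : MulAction G (MilnorE G) where
  smul a e :=
    { t := e.t
      g := fun i => (e.g i).map (a * ·)
      nonneg := e.nonneg
      sum_eq_one := e.sum_eq_one
      g_eq_none_iff := fun i => by rw [Option.map_eq_none_iff, e.g_eq_none_iff] }
  one_smul e := by
    refine MilnorE.ext rfl (funext fun i => ?_)
    change (e.g i).map (1 * ·) = e.g i
    cases e.g i <;> simp
  mul_smul a b e := by
    refine MilnorE.ext rfl (funext fun i => ?_)
    change (e.g i).map (a * b * ·) = ((e.g i).map (b * ·)).map (a * ·)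
    cases e.g i <;> simp [mul_assoc]

/-- The classifying space `BG = EG / G`, with the quotient topology. -/
abbrev MilnorB (G : Type u) [Group G] : Type u := Quotient (MulAction.orbitRel G (MilnorE G))

/-! ### The projective unitary group and classifying maps of `M_l(ℂ)`-bundles -/

/-- The projective unitary group `PU(n)`, the quotient of `U(n)` by its center. -/
abbrev PU (n : ℕ) : Type :=
  Matrix.unitaryGroup (Fin n) ℂ ⧸ Subgroup.center (Matrix.unitaryGroup (Fin n) ℂ)

open scoped Matrix.Norms.L2Operator in
theorem conj_eq_one_of_mem_center (n : ℕ) (z : Matrix.unitaryGroup (Fin n) ℂ)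
    (hz : z ∈ Subgroup.center (Matrix.unitaryGroup (Fin n) ℂ)) :
    Unitary.conjStarAlgAut ℂ (Mat n) z = 1 := by
  have key : ∀ T : Mat n, T * (z : Mat n) = (z : Mat n) * T := by
    intro T
    obtain ⟨y, c, rfl, -⟩ := CStarAlgebra.exists_sum_four_unitary T
    simp only [Finset.sum_mul, Finset.mul_sum, smul_mul_assoc, mul_smul_comm]
    refine Finset.sum_congr rfl fun i _ => ?_
    have h := Subgroup.mem_center_iff.1 hz (y i)
    have h2 : ((y i : Mat n)) * (z : Mat n) = (z : Mat n) * (y i : Mat n) :=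
      congrArg (fun a : Matrix.unitaryGroup (Fin n) ℂ => (a : Mat n)) h
    rw [h2]
  ext1 T
  rw [Unitary.conjStarAlgAut_apply, ← key, mul_assoc, Unitary.mul_star_self_of_mem z.2, mul_one]
  rfl

/-- The action of `PU(n)` on `M_n(ℂ)` by conjugation, `T ↦ u T u^*`. -/
def PU.conj (n : ℕ) : PU n →* (Mat n ≃⋆ₐ[ℂ] Mat n) :=
  QuotientGroup.lift _ (Unitary.conjStarAlgAut ℂ (Mat n)) (conj_eq_one_of_mem_center n)

/-- Milnor's model of the total space of the universal principal `PU(l)`-bundle. -/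
abbrev EPU (l : ℕ) : Type := MilnorE (PU l)

/-- The classifying space `BPU(l)`. -/
abbrev BPU (l : ℕ) : Type := MilnorB (PU l)

namespace StarAlgBundle

variable {X : Type u}

/-- The points of the bundle of frames of an `M_l(ℂ)`-bundle `B`: pairs of a point `x` and a
`*`-isomorphism `M_l(ℂ) → B_x`. -/
structure Frame (l : ℕ) (B : StarAlgBundle.{u, v} X) where
  /-- the base point -/
  base : X
  /-- the frame of the fiber -/
  iso : Mat l ≃⋆ₐ[ℂ] B.Fiber base

/-- The topology of pointwise convergence: `(x, j) ↦ (x, j(T)) ∈ B` is continuous for all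
`T ∈ M_l(ℂ)`. -/
instance Frame.instTopologicalSpace (l : ℕ) (B : StarAlgBundle.{u, v} X) :
    TopologicalSpace (Frame l B) :=
  TopologicalSpace.induced (fun j => fun T : Mat l => (⟨j.base, j.iso T⟩ : B.Total)) inferInstance

/-- The right action of `PU(l)` on frames, `j · a = j ∘ Ad(a)`. -/
def Frame.act {l : ℕ} {B : StarAlgBundle.{u, v} X} (j : Frame l B) (a : PU l) : Frame l B :=
  ⟨j.base, (PU.conj l a).trans j.iso⟩

/-- `φ : X → BPU(l)` is a classifying map of the `M_l(ℂ)`-bundle `B`: it is covered by a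
morphism of principal `PU(l)`-bundles from the bundle of frames of `B` to `EPU(l) → BPU(l)`
(the right action of `a` on `EPU(l)` being the left action of `a⁻¹`), i.e. the bundle of frames of
`B` is the pullback of the universal bundle along `φ`. -/
def IsClassifyingMap [TopologicalSpace X] (l : ℕ) (B : StarAlgBundle.{u, v} X)
    (φ : C(X, BPU l)) : Prop :=
  ∃ Φ : Frame l B → EPU l, Continuous Φ ∧
    (∀ (j : Frame l B) (a : PU l), Φ (j.act a) = a⁻¹ • Φ j) ∧
    ∀ j : Frame l B, φ j.base = Quotient.mk _ (Φ j)

/-! ### Trivializations of `[M_k] ⊗ B` and maps to `Fr_{k,l}` -/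

/-- A trivialization of `B` after tensoring with `[M_k]`, i.e. an isomorphism
`[M_k] ⊗ B ≅ X × M_{kl}(ℂ)`. -/
abbrev StableTriv [TopologicalSpace X] (k l : ℕ) (B : StarAlgBundle.{u, v} X) : Type (max u v) :=
  Iso (B.tensorMatrix k) (trivial X (k * l))

/-- The value of a trivialization on a vector of the fiber `M_k(ℂ) ⊗ B_x`. -/
def StableTriv.app [TopologicalSpace X] {k l : ℕ} {B : StarAlgBundle.{u, v} X}
    (θ : StableTriv k l B) (x : X) (s : Mat k ⊗[ℂ] B.Fiber x) : Mat (k * l) :=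
  Iso.fiber θ x s

/-- The value in `M_{kl}(ℂ)` of an isomorphism from `B` to the pullback of the bundle of
centralizers. -/
def centralizerApp [TopologicalSpace X] {k l : ℕ} {B : StarAlgBundle.{u, v} X} {f : C(X, Fr k l)}
    (α : Iso B (pullback f (centralizerBundle k l))) (x : X) (b : B.Fiber x) : Mat (k * l) :=
  Subtype.val (p := fun T : Mat (k * l) => T ∈ StarSubalgebra.centralizer ℂ (Set.range (f x)))
    (α.fiber x b)

/-- The trivialization `θ` restricts on the factor `[M_k]` to the family of homomorphisms `f`:
`θ_x(T ⊗ 1) = f_x(T)`. -/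
def StableTriv.Induces [TopologicalSpace X] {k l : ℕ} {B : StarAlgBundle.{u, v} X}
    (θ : StableTriv k l B) (f : C(X, Fr k l)) : Prop :=
  ∀ (x : X) (T : Mat k), StableTriv.app θ x (T ⊗ₜ[ℂ] (1 : B.Fiber x)) = f x T

/-- The trivialization `θ` restricts to `f` on the factor `[M_k]` and to
`α : B ≅ f^*(centralizers)` on the factor `B`: `θ_x(T ⊗ 1) = f_x(T)` and `θ_x(1 ⊗ b) = α_x(b)`. -/
def StableTriv.Corresponds [TopologicalSpace X] {k l : ℕ} {B : StarAlgBundle.{u, v} X}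
    (θ : StableTriv k l B) (f : C(X, Fr k l))
    (α : Iso B (pullback f (centralizerBundle k l))) : Prop :=
  StableTriv.Induces θ f ∧
    ∀ (x : X) (b : B.Fiber x), StableTriv.app θ x ((1 : Mat k) ⊗ₜ[ℂ] b) = centralizerApp α x b

end StarAlgBundle

end

/-!
# Maps to `Fr_{k,l}` and trivializations of `[M_k] ⊗ B`

**The centralizer bundle.** For a unital `*`-homomorphism `h : M_k(ℂ) → M_N(ℂ)` every matrix has a
unique expansion `z = ∑ h(E_ij) z_ij` with coefficients `z_ij = ∑_m h(E_mi) z h(E_jm)` in the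
centralizer of `h` (`unitCoeff`).  If the columns of `V` are an orthonormal basis of the range of
the projection `h(E_00)`, then `b ↦ V* b V` identifies this centralizer with `M_l(ℂ)`
(`IsCornerIsometry.starAlgEquiv`).  Polar decomposition lets `V` depend continuously on `h` near any
given point, which trivializes the bundle of centralizers locally.

**Trivializations.** The same expansion shows that a `*`-isomorphism `M_k(ℂ) ⊗ A ≅ M_N(ℂ)` is the
same as a unital `*`-homomorphism `h` together with a `*`-isomorphism from `A` to the centralizer of
`h` (`restrictCentralizer`, `tensorCentralizerEquiv`).  The formulas for these isomorphisms and
their inverses are explicit, so they are continuous in families; this is the correspondence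
`θ ↔ (f, α)`, from which the classification of pairs `(B, θ)` follows.

**Classifying maps.** `PU(n)` is compact and acts faithfully on `M_n(ℂ)`, and every
`*`-automorphism of `M_n(ℂ)` is inner, so `PU(n)` is `Aut(M_n(ℂ))` with the topology of pointwise
convergence.  Hence local frames make the bundle of frames a principal bundle in the required sense.
As `Fr_{k,l}` is metrizable and second countable, a partition of unity gives a classifying map of
the centralizer bundle, and pulling it back gives the one of `B`.  Two classifying maps of one
bundle are homotopic over an arbitrary base (`IsClassifyingMap.homotopic`): in Milnor's infinite
join, the covering equivariant maps can be moved to the even and the odd positions, where they are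
joined by segments.  Conversely, as the translation function of `EPU(l)` is continuous
(`MilnorE.continuous_of_smul_eq`), bundles with a common classifying map are isomorphic
(`IsClassifyingMap.nonempty_iso`); so `ψ ∘ f` classifies `B` exactly if `B` is isomorphic to the
pullback of the centralizer bundle along `f`.
-/

universe v'

noncomputable section

open Matrix

/-! ### Matrix units and centralizers -/

/-- For a `*`-homomorphism `h : M_k(ℂ) → M_N(ℂ)` this is the linear map which extracts the
`(i, j)` coefficient of a matrix: `z = ∑ h(E_ij) * unitCoeff h i j z` with coefficients in the
centralizer of the image of `h`. -/
def unitCoeff {k N : ℕ} (h : Mat k →⋆ₐ[ℂ] Mat N) (i j : Fin k) : Mat N →ₗ[ℂ] Mat N where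
  toFun z := ∑ m, h (single m i 1) * z * h (single j m 1)
  map_add' a b := by simp [mul_add, add_mul, Finset.sum_add_distrib]
  map_smul' c a := by simp [Finset.smul_sum]

section unitCoeff

variable {k N : ℕ} (h : Mat k →⋆ₐ[ℂ] Mat N)

theorem unitCoeff_apply (i j : Fin k) (z : Mat N) :
    unitCoeff h i j z = ∑ m, h (single m i 1) * z * h (single j m 1) := rfl

theorem starHom_eq_sum (T : Mat k) : h T = ∑ i, ∑ j, T i j • h (single i j 1) := by
  conv_lhs => rw [matrix_eq_sum_single T]
  simp only [map_sum]
  refine Finset.sum_congr rfl fun i _ => Finset.sum_congr rfl fun j _ => ?_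
  rw [← map_smul, smul_single, smul_eq_mul, mul_one]

theorem mul_single_eq_sum (T : Mat k) (m i : Fin k) :
    T * single m i (1 : ℂ) = ∑ a, T a m • single a i (1 : ℂ) := by
  ext p q
  simp [Matrix.mul_apply, Matrix.sum_apply, single_apply, ite_and]

theorem single_mul_eq_sum (T : Mat k) (j m : Fin k) :
    single j m (1 : ℂ) * T = ∑ a, T m a • single j a (1 : ℂ) := by
  ext p q
  simp [Matrix.mul_apply, Matrix.sum_apply, single_apply, ite_and]

theorem commute_unitCoeff (T : Mat k) (i j : Fin k) (z : Mat N) :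
    h T * unitCoeff h i j z = unitCoeff h i j z * h T := by
  have h1 : h T * unitCoeff h i j z =
      ∑ m, ∑ a, T a m • (h (single a i 1) * z * h (single j m 1)) := by
    rw [unitCoeff_apply, Finset.mul_sum]
    refine Finset.sum_congr rfl fun m _ => ?_
    rw [← mul_assoc, ← mul_assoc, ← map_mul, mul_single_eq_sum]
    simp only [map_sum, map_smul, Finset.sum_mul, smul_mul_assoc]
  have h2 : unitCoeff h i j z * h T =
      ∑ m, ∑ a, T m a • (h (single m i 1) * z * h (single j a 1)) := by
    rw [unitCoeff_apply, Finset.sum_mul]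
    refine Finset.sum_congr rfl fun m _ => ?_
    rw [mul_assoc, ← map_mul, single_mul_eq_sum]
    simp only [map_sum, map_smul, Finset.mul_sum, mul_smul_comm]
  rw [h1, h2, Finset.sum_comm]

theorem mem_centralizer_range_iff {z : Mat N} :
    z ∈ StarSubalgebra.centralizer ℂ (Set.range h) ↔ ∀ T, h T * z = z * h T := by
  rw [StarSubalgebra.mem_centralizer_iff]
  constructor
  · intro hz T
    exact (hz _ ⟨T, rfl⟩).1
  · rintro hz _ ⟨T, rfl⟩
    refine ⟨hz T, ?_⟩
    rw [← map_star]
    exact hz _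

theorem unitCoeff_mem_centralizer (i j : Fin k) (z : Mat N) :
    unitCoeff h i j z ∈ StarSubalgebra.centralizer ℂ (Set.range h) :=
  (mem_centralizer_range_iff h).2 fun T => commute_unitCoeff h T i j z

theorem sum_single_diag : ∑ m : Fin k, h (single m m 1) = 1 := by
  rw [← map_sum, sum_single_one, map_one]

/-- Every matrix is recovered from its coefficients. -/
theorem sum_mul_unitCoeff (z : Mat N) :
    ∑ i, ∑ j, h (single i j 1) * unitCoeff h i j z = z := by
  have : ∀ i j, h (single i j 1) * unitCoeff h i j z =
      h (single i i 1) * z * h (single j j 1) := by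
    intro i j
    rw [unitCoeff_apply, Finset.mul_sum, Finset.sum_eq_single j]
    · rw [← mul_assoc, ← mul_assoc, ← map_mul, single_mul_single_same, mul_one]
    · intro m _ hm
      rw [← mul_assoc, ← mul_assoc, ← map_mul, single_mul_single_of_ne _ _ _ _ hm.symm]
      simp
    · simp
  simp_rw [this, ← Finset.mul_sum, sum_single_diag, mul_one, ← Finset.sum_mul, sum_single_diag,
    one_mul]

/-- The coefficients in the centralizer are unique; for `T = 1` an element of the centralizer is its
own diagonal coefficient. -/
theorem unitCoeff_mul (T : Mat k) (i j : Fin k) {b : Mat N}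
    (hb : ∀ T, h T * b = b * h T) : unitCoeff h i j (h T * b) = T i j • b := by
  have : ∀ m, h (single m i 1) * (h T * b) * h (single j m 1) = T i j • (h (single m m 1) * b) := by
    intro m
    rw [mul_assoc, mul_assoc, ← hb, ← mul_assoc, ← mul_assoc, ← map_mul, ← map_mul,
      single_mul_mul_single, one_mul, mul_one,
      show single m m (T i j) = T i j • single m m (1 : ℂ) by simp, map_smul, smul_mul_assoc]
  rw [unitCoeff_apply]
  simp_rw [this, ← Finset.smul_sum, ← Finset.sum_mul, sum_single_diag, one_mul]

theorem conjTranspose_starHom_single (i j : Fin k) :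
    (h (single i j 1))ᴴ = h (single j i 1) := by
  rw [← star_eq_conjTranspose, ← map_star, star_eq_conjTranspose, conjTranspose_single, star_one]

end unitCoeff

/-- A *corner isometry* of `h : M_k(ℂ) → M_N(ℂ)`: the columns of `V` are an orthonormal basis of the
range of the projection `h(E_ii)`. -/
structure IsCornerIsometry {k N l : ℕ} (h : Mat k →⋆ₐ[ℂ] Mat N) (i : Fin k)
    (V : Matrix (Fin N) (Fin l) ℂ) : Prop where
  isometry : Vᴴ * V = 1
  range : V * Vᴴ = h (single i i 1)

namespace IsCornerIsometry

variable {k N l : ℕ} {h : Mat k →⋆ₐ[ℂ] Mat N} {i : Fin k} {V : Matrix (Fin N) (Fin l) ℂ}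

theorem proj_mul (hV : IsCornerIsometry h i V) : h (single i i 1) * V = V := by
  rw [← hV.range, Matrix.mul_assoc, hV.isometry, Matrix.mul_one]

theorem mul_proj (hV : IsCornerIsometry h i V) : Vᴴ * h (single i i 1) = Vᴴ := by
  rw [← hV.range, ← Matrix.mul_assoc, hV.isometry, Matrix.one_mul]

/-- The compression `b ↦ V* b V` identifies the centralizer of `h` with `M_l(ℂ)`. -/
def starAlgEquiv (hV : IsCornerIsometry h i V) :
    StarSubalgebra.centralizer ℂ (Set.range h) ≃⋆ₐ[ℂ] Mat l where
  toFun b := Vᴴ * (b : Mat N) * V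
  invFun S := ⟨unitCoeff h i i (V * S * Vᴴ), unitCoeff_mem_centralizer h i i _⟩
  left_inv := by
    rintro ⟨b, hb⟩
    rw [mem_centralizer_range_iff] at hb
    ext1
    change unitCoeff h i i (V * (Vᴴ * b * V) * Vᴴ) = b
    -- `e b e = e b` for the projection `e = h(E_ii)`, and the coefficient of `e b` is `b`
    have : V * (Vᴴ * b * V) * Vᴴ = h (single i i 1) * b := by
      calc V * (Vᴴ * b * V) * Vᴴ = (V * Vᴴ) * b * (V * Vᴴ) := by simp only [Matrix.mul_assoc]
        _ = _ := by
          rw [hV.range, hb, Matrix.mul_assoc, ← map_mul, single_mul_single_same, mul_one]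
    rw [this, unitCoeff_mul h _ _ _ hb]
    simp
  right_inv := by
    intro S
    change Vᴴ * unitCoeff h i i (V * S * Vᴴ) * V = S
    have : ∀ m, Vᴴ * h (single m i 1) * V = if m = i then 1 else 0 := by
      intro m
      split_ifs with hm
      · rw [hm, hV.mul_proj, hV.isometry]
      · rw [← hV.mul_proj, Matrix.mul_assoc Vᴴ, ← map_mul,
          single_mul_single_of_ne _ _ _ _ (Ne.symm hm)]
        simp
    rw [unitCoeff_apply, Matrix.mul_sum, Matrix.sum_mul, Finset.sum_eq_single i]
    · calc Vᴴ * (h (single i i 1) * (V * S * Vᴴ) * h (single i i 1)) * V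
          = (Vᴴ * h (single i i 1) * V) * S * (Vᴴ * h (single i i 1) * V) := by
            simp only [Matrix.mul_assoc]
        _ = S := by rw [this, if_pos rfl, Matrix.one_mul, Matrix.mul_one]
    · intro m _ hm
      calc Vᴴ * (h (single m i 1) * (V * S * Vᴴ) * h (single i m 1)) * V
          = (Vᴴ * h (single m i 1) * V) * S * (Vᴴ * h (single i m 1) * V) := by
            simp only [Matrix.mul_assoc]
        _ = 0 := by rw [this, if_neg hm, Matrix.zero_mul, Matrix.zero_mul]
    · simp
  map_mul' := by
    rintro ⟨a, ha⟩ ⟨b, hb⟩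
    rw [mem_centralizer_range_iff] at ha hb
    change Vᴴ * (a * b) * V = (Vᴴ * a * V) * (Vᴴ * b * V)
    calc Vᴴ * (a * b) * V = Vᴴ * a * (b * (h (single i i 1) * V)) := by
          rw [hV.proj_mul]; simp only [Matrix.mul_assoc]
      _ = Vᴴ * a * (h (single i i 1) * b * V) := by rw [hb]; simp only [Matrix.mul_assoc]
      _ = _ := by rw [← hV.range]; simp only [Matrix.mul_assoc]
  map_add' a b := by
    simp [Matrix.mul_add, Matrix.add_mul]
  map_star' a := by
    simp [star_eq_conjTranspose, Matrix.mul_assoc]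
  map_smul' c a := by
    simp

open scoped ComplexOrder in
/-- An isometry into the range of the projection `h(E_ii)` is onto if the traces agree. -/
theorem of_isometry (hV : Vᴴ * V = 1) (hr : h (single i i 1) * V = V)
    (ht : (h (single i i 1)).trace = l) : IsCornerIsometry h i V := by
  refine ⟨hV, ?_⟩
  set e := h (single i i 1) with he
  have hee : e * e = e := by rw [he, ← map_mul, single_mul_single_same, mul_one]
  have hes : eᴴ = e := conjTranspose_starHom_single h i i
  have hr' : Vᴴ * e = Vᴴ := by rw [← hes, ← conjTranspose_mul, hr]
  -- the difference is a projection of trace `0`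
  have hD : (e - V * Vᴴ)ᴴ * (e - V * Vᴴ) = e - V * Vᴴ := by
    rw [conjTranspose_sub, hes, conjTranspose_mul, conjTranspose_conjTranspose, Matrix.sub_mul,
      Matrix.mul_sub, Matrix.mul_sub, hee, ← Matrix.mul_assoc, hr, Matrix.mul_assoc V Vᴴ e, hr',
      Matrix.mul_assoc V Vᴴ (V * Vᴴ), ← Matrix.mul_assoc Vᴴ V, hV, Matrix.one_mul, sub_self,
      sub_zero]
  have : e - V * Vᴴ = 0 := by
    rw [← trace_conjTranspose_mul_self_eq_zero_iff, hD, trace_sub, ht, trace_mul_comm, hV,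
      trace_one, Fintype.card_fin, sub_self]
  exact (sub_eq_zero.1 this).symm

end IsCornerIsometry

/-- A self-adjoint projection of trace `l` is `V V*` for an isometry `V` defined on `ℂ^l`. -/
theorem exists_isometry_of_isProjection {N l : ℕ} (e : Mat N) (hee : e * e = e) (hes : eᴴ = e)
    (ht : e.trace = l) : ∃ V : Matrix (Fin N) (Fin l) ℂ, Vᴴ * V = 1 ∧ V * Vᴴ = e := by
  have hH : e.IsHermitian := hes
  have h01 : ∀ a, hH.eigenvalues a = 0 ∨ hH.eigenvalues a = 1 := by
    intro a
    have h1 := hH.mulVec_eigenvectorBasis a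
    have h2 : e *ᵥ (e *ᵥ (hH.eigenvectorBasis a).ofLp) = e *ᵥ (hH.eigenvectorBasis a).ofLp := by
      rw [mulVec_mulVec, hee]
    rw [h1, mulVec_smul, h1, smul_smul] at h2
    have hne : (hH.eigenvectorBasis a).ofLp ≠ 0 := by
      intro h0
      have := hH.eigenvectorBasis.orthonormal.ne_zero a
      exact this (by ext b; exact congrFun h0 b)
    have h3 := smul_left_injective ℝ hne h2
    have h4 : hH.eigenvalues a * (hH.eigenvalues a - 1) = 0 := by linarith
    rcases mul_eq_zero.1 h4 with h5 | h5
    · exact Or.inl h5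
    · exact Or.inr (by linarith)
  -- the multiplicity of the eigenvalue `1` is the trace; `V` consists of its eigenvectors
  have hcard : Fintype.card {a // hH.eigenvalues a = 1} = l := by
    have h1 := hH.trace_eq_sum_eigenvalues
    rw [ht] at h1
    have h2 : ∀ a, ((hH.eigenvalues a : ℝ) : ℂ) = if hH.eigenvalues a = 1 then 1 else 0 := by
      intro a
      rcases h01 a with h | h <;> simp [h]
    simp only [Complex.coe_algebraMap, h2] at h1
    rw [Fintype.card_subtype]
    simp at h1
    exact_mod_cast h1.symm
  let σ : Fin l ≃ {a // hH.eigenvalues a = 1} :=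
    (Fintype.equivFinOfCardEq hcard).symm
  let U : Mat N := hH.eigenvectorUnitary
  have hU : Uᴴ * U = 1 := Unitary.star_mul_self_of_mem hH.eigenvectorUnitary.2
  refine ⟨U.submatrix id (fun c => (σ c : Fin N)), ?_, ?_⟩
  · rw [conjTranspose_submatrix, ← submatrix_mul _ _ _ _ _ Function.bijective_id, hU]
    exact submatrix_one _ (Subtype.val_injective.comp σ.injective)
  · conv_rhs => rw [hH.spectral_theorem]
    rw [Unitary.conjStarAlgAut_apply]
    change _ = U * _ * Uᴴ
    ext p q
    rw [Matrix.mul_apply, Matrix.mul_apply]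
    simp only [Matrix.mul_diagonal, submatrix_apply, conjTranspose_apply, id, Function.comp]
    have h2 : ∀ a, U p a * ((hH.eigenvalues a : ℝ) : ℂ) * star (U q a) =
        if hH.eigenvalues a = 1 then U p a * star (U q a) else 0 := by
      intro a
      rcases h01 a with h | h <;> simp [h]
    simp only [Complex.coe_algebraMap, h2]
    rw [← Finset.sum_filter, ← Finset.sum_subtype_eq_sum_filter]
    simp only [Finset.subtype_univ]
    exact σ.sum_comp (fun a => U p a.1 * star (U q a.1))

theorem trace_starHom_single {k N l : ℕ} (hN : N = k * l) (h : Mat k →⋆ₐ[ℂ] Mat N) (i : Fin k) :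
    (h (single i i 1)).trace = l := by
  have h1 : ∀ j, (h (single j j 1)).trace = (h (single i i 1)).trace := by
    intro j
    rw [show single j j (1 : ℂ) = single j i 1 * single i j 1 by simp, map_mul, trace_mul_comm,
      ← map_mul]
    simp
  have h2 := congrArg trace (sum_single_diag h)
  rw [trace_sum] at h2
  simp only [h1, trace_one, Finset.sum_const, Finset.card_univ, Fintype.card_fin,
    nsmul_eq_mul, hN, Nat.cast_mul] at h2
  have hk : (k : ℂ) ≠ 0 := by
    have := i.pos
    exact_mod_cast this.ne'
  exact mul_left_cancel₀ hk h2

theorem exists_isCornerIsometry {k N l : ℕ} (hN : N = k * l) (h : Mat k →⋆ₐ[ℂ] Mat N) (i : Fin k) :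
    ∃ V : Matrix (Fin N) (Fin l) ℂ, IsCornerIsometry h i V := by
  obtain ⟨V, h1, h2⟩ := exists_isometry_of_isProjection (h (single i i 1))
    (by rw [← map_mul, single_mul_single_same, mul_one]) (conjTranspose_starHom_single h i i)
    (trace_starHom_single hN h i)
  exact ⟨V, h1, h2⟩

/-! ### Continuous families of orthonormal frames -/

open scoped Matrix.Norms.L2Operator MatrixOrder ComplexOrder in
/-- The function `G ↦ G^(-1/2)` on positive definite matrices is continuous. -/
theorem exists_continuousOn_inv_sqrt (l : ℕ) : ∃ R : Mat l → Mat l,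
    ContinuousOn R {G | G.PosDef} ∧ ∀ G : Mat l, G.PosDef → (R G)ᴴ = R G ∧ R G * G * R G = 1 := by
  have hunit : ∀ G : Mat l, G.PosDef → IsUnit (CFC.sqrt G) := by
    intro G hG
    exact (CFC.isUnit_sqrt_iff G hG.posSemidef.nonneg).2 hG.isUnit
  refine ⟨fun G => (CFC.sqrt G)⁻¹, ?_, ?_⟩
  · intro G hG
    have h1 : ContinuousWithinAt (CFC.sqrt : Mat l → Mat l) {G | G.PosDef} G :=
      (CFC.continuousOn_sqrt G hG.posSemidef.nonneg).mono fun A hA => hA.posSemidef.nonneg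
    have h2 : ContinuousAt (Inv.inv : Mat l → Mat l) (CFC.sqrt G) := by
      refine continuousAt_matrix_inv _ ?_
      have h3 := (Matrix.isUnit_iff_isUnit_det _).1 (hunit G hG)
      rw [Ring.inverse_eq_inv']
      exact continuousAt_inv₀ h3.ne_zero
    exact h2.comp_continuousWithinAt h1
  · intro G hG
    have hs := CFC.sqrt_mul_sqrt_self G hG.posSemidef.nonneg
    have hd := (Matrix.isUnit_iff_isUnit_det _).1 (hunit G hG)
    have hsa : (CFC.sqrt G)ᴴ = CFC.sqrt G := (CFC.sqrt_nonneg G).isSelfAdjoint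
    refine ⟨by rw [conjTranspose_nonsing_inv, hsa], ?_⟩
    change (CFC.sqrt G)⁻¹ * G * (CFC.sqrt G)⁻¹ = 1
    nth_rewrite 2 [← hs]
    rw [← Matrix.mul_assoc, Matrix.nonsing_inv_mul _ hd, Matrix.one_mul,
      Matrix.mul_nonsing_inv _ hd]

theorem Fr.continuous_apply {k l : ℕ} (T : Mat k) : Continuous fun h : Fr k l => h T :=
  (_root_.continuous_apply T).comp continuous_induced_dom

open scoped ComplexOrder in
/-- Corner isometries can be chosen continuously near every point of `Fr_{k,l}`: the isometric part
of `h(E_ii) V₀` in its polar decomposition works, as long as this matrix has full rank. -/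
theorem exists_continuousOn_isCornerIsometry {k l : ℕ} (i : Fin k) (h₀ : Fr k l) :
    ∃ (U : Set (Fr k l)) (V : Fr k l → Matrix (Fin (k * l)) (Fin l) ℂ), IsOpen U ∧ h₀ ∈ U ∧
      ContinuousOn V U ∧ ∀ h ∈ U, IsCornerIsometry h i (V h) := by
  obtain ⟨V₀, hV₀⟩ := exists_isCornerIsometry rfl h₀ i
  obtain ⟨R, hRc, hR⟩ := exists_continuousOn_inv_sqrt l
  let X : Fr k l → Matrix (Fin (k * l)) (Fin l) ℂ := fun h => h (single i i 1) * V₀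
  let G : Fr k l → Mat l := fun h => (X h)ᴴ * X h
  have hX : Continuous X := (Fr.continuous_apply _).matrix_mul continuous_const
  have hG : Continuous G := hX.matrix_conjTranspose.matrix_mul hX
  have hpos : ∀ h, (G h).det ≠ 0 → (G h).PosDef := by
    intro h hdet
    refine (posSemidef_conjTranspose_mul_self (X h)).posDef_iff_isUnit.2 ?_
    exact (Matrix.isUnit_iff_isUnit_det _).2 (isUnit_iff_ne_zero.2 hdet)
  refine ⟨{h | (G h).det ≠ 0}, fun h => X h * R (G h), ?_, ?_, ?_, ?_⟩
  · exact isOpen_ne_fun hG.matrix_det continuous_const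
  · have : G h₀ = 1 := by
      simp only [G, X]
      rw [hV₀.proj_mul, hV₀.isometry]
    simp [this]
  · have h1 : ContinuousOn (fun h => R (G h)) {h | (G h).det ≠ 0} :=
      hRc.comp hG.continuousOn fun h hh => hpos h hh
    rw [continuousOn_iff_continuous_domRestrict] at h1 ⊢
    exact (hX.comp continuous_subtype_val).matrix_mul h1
  · intro h hh
    obtain ⟨h1, h2⟩ := hR _ (hpos h hh)
    refine IsCornerIsometry.of_isometry ?_ ?_ (trace_starHom_single rfl h i)
    · rw [conjTranspose_mul, h1, Matrix.mul_assoc, ← Matrix.mul_assoc (X h)ᴴ, ← Matrix.mul_assoc]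
      exact h2
    · rw [← Matrix.mul_assoc, ← Matrix.mul_assoc, ← map_mul, single_mul_single_same, mul_one]

/-! ### Local frames of bundles of matrix algebras -/

namespace StarAlgBundle

variable {X : Type u}

/-- A local trivialization of a bundle of `*`-algebras over an open set, given by `*`-isomorphisms
of the fibers with `M_n(ℂ)`. -/
structure LocalFrame [TopologicalSpace X] (n : ℕ) (B : StarAlgBundle.{u, v} X) where
  /-- the open set over which the bundle is trivialized -/
  base : Set X
  isOpen_base : IsOpen base
  /-- the coordinates on the fibers -/
  coord : ∀ x : base, B.Fiber x ≃⋆ₐ[ℂ] Mat n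
  continuous_coord :
    Continuous fun p : {p : B.Total // p.1 ∈ base} => coord ⟨p.1.1, p.2⟩ p.1.2
  continuous_symm :
    Continuous fun q : base × Mat n => (⟨q.1, (coord q.1).symm q.2⟩ : B.Total)

variable [TopologicalSpace X]

theorem IsMatrixBundle.continuous_proj {n : ℕ} {B : StarAlgBundle.{u, v} X}
    (hB : B.IsMatrixBundle n) : Continuous B.proj := by
  rw [continuous_iff_continuousAt]
  intro p
  obtain ⟨e, he, -⟩ := hB p.1
  exact e.continuousAt_proj (e.mem_source.2 he)

theorem IsMatrixBundle.exists_localFrame {n : ℕ} {B : StarAlgBundle.{u, v} X}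
    (hB : B.IsMatrixBundle n) (x : X) : ∃ L : LocalFrame n B, x ∈ L.base := by
  obtain ⟨e, hx, he⟩ := hB x
  choose i hi using he
  refine ⟨⟨e.baseSet, e.open_baseSet, fun y => i y y.2, ?_, ?_⟩, hx⟩
  · have h1 : Continuous fun p : {p : B.Total // p.1 ∈ e.baseSet} => (e p.1).2 := by
      have h2 := continuousOn_iff_continuous_domRestrict.1 e.continuousOn_toFun
      refine continuous_snd.comp (h2.comp (f := fun p : {p : B.Total // p.1 ∈ e.baseSet} =>
        (⟨p.1, e.mem_source.2 p.2⟩ : e.source)) ?_)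
      exact continuous_subtype_val.subtype_mk _
    convert h1 using 2 with p
    exact (hi _ p.2 p.1.2).symm
  · have h2 := continuousOn_iff_continuous_domRestrict.1 e.continuousOn_invFun
    have h3 : Continuous fun q : e.baseSet × Mat n => e.toOpenPartialHomeomorph.symm (q.1.1, q.2) :=
      h2.comp (f := fun q : e.baseSet × Mat n =>
        (⟨(q.1.1, q.2), e.mem_target.2 q.1.2⟩ : e.target)) (by fun_prop)
    convert h3 using 2 with q
    have h5 : (⟨q.1, (i q.1 q.1.2).symm q.2⟩ : B.Total) ∈ e.source := e.mem_source.2 q.1.2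
    have h4 : e ⟨q.1, (i q.1 q.1.2).symm q.2⟩ = (q.1.1, q.2) := by
      refine Prod.ext (e.coe_fst h5) ?_
      rw [hi _ q.1.2]
      simp
    rw [← h4]
    exact (e.toOpenPartialHomeomorph.left_inv h5).symm

theorem isMatrixBundle_of_localFrame {n : ℕ} {B : StarAlgBundle.{u, v} X}
    (hp : Continuous B.proj) (hL : ∀ x, ∃ L : LocalFrame n B, x ∈ L.base) :
    B.IsMatrixBundle n := by
  classical
  intro x
  obtain ⟨L, hx⟩ := hL x
  let φ : B.Total → X × Mat n := fun p =>
    (p.1, if hp : p.1 ∈ L.base then L.coord ⟨p.1, hp⟩ p.2 else 0)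
  let inv : X × Mat n → B.Total := fun q =>
    if hq : q.1 ∈ L.base then ⟨q.1, (L.coord ⟨q.1, hq⟩).symm q.2⟩ else ⟨q.1, 0⟩
  have hφ : ∀ (y : X) (hy : y ∈ L.base) b, φ ⟨y, b⟩ = (y, L.coord ⟨y, hy⟩ b) := by
    intro y hy b
    simp only [φ, dif_pos hy]
  have hinv : ∀ (y : X) (hy : y ∈ L.base) T, inv (y, T) = ⟨y, (L.coord ⟨y, hy⟩).symm T⟩ := by
    intro y hy T
    simp only [inv, dif_pos hy]
  refine ⟨{ toFun := φ, invFun := inv, source := B.proj ⁻¹' L.base, target := L.base ×ˢ Set.univ,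
            baseSet := L.base, open_baseSet := L.isOpen_base, source_eq := rfl, target_eq := rfl,
            open_source := L.isOpen_base.preimage hp,
            open_target := L.isOpen_base.prod isOpen_univ,
            map_source' := ?_, map_target' := ?_, left_inv' := ?_, right_inv' := ?_,
            continuousOn_toFun := ?_, continuousOn_invFun := ?_, proj_toFun := ?_ }, hx, ?_⟩
  · rintro ⟨y, b⟩ hy
    exact ⟨hy, Set.mem_univ _⟩
  · rintro ⟨y, T⟩ ⟨hy, -⟩
    rw [hinv y hy]
    exact hy
  · rintro ⟨y, b⟩ hy
    rw [hφ y hy, hinv y hy, StarAlgEquiv.symm_apply_apply]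
  · rintro ⟨y, T⟩ ⟨hy, -⟩
    rw [hinv y hy, hφ y hy, StarAlgEquiv.apply_symm_apply]
  · rw [continuousOn_iff_continuous_domRestrict]
    refine ((hp.comp continuous_subtype_val).prodMk L.continuous_coord).congr ?_
    rintro ⟨⟨y, b⟩, hy⟩
    exact (hφ y hy b).symm
  · rw [continuousOn_iff_continuous_domRestrict]
    have : Continuous fun q : (L.base ×ˢ (Set.univ : Set (Mat n)) : Set (X × Mat n)) =>
        ((⟨q.1.1, q.2.1⟩, q.1.2) : L.base × Mat n) := by fun_prop
    refine (L.continuous_symm.comp this).congr ?_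
    rintro ⟨⟨y, T⟩, hy, -⟩
    exact (hinv y hy T).symm
  · rintro ⟨y, b⟩ hy
    rfl
  · intro y hy
    exact ⟨L.coord ⟨y, hy⟩, fun b => congrArg Prod.snd (hφ y hy b)⟩

theorem pullback_total_continuous_iff {Y : Type w} [TopologicalSpace Y] {f : C(X, Y)}
    {B : StarAlgBundle.{w, v} Y} {Z : Type*} [TopologicalSpace Z]
    {g : Z → (pullback f B).Total} :
    Continuous g ↔ Continuous (fun z => (g z).1) ∧
      Continuous (fun z => (⟨f (g z).1, (g z).2⟩ : B.Total)) :=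
  continuous_induced_rng.trans continuous_prodMk

theorem continuous_pullback_proj {Y : Type w} [TopologicalSpace Y] (f : C(X, Y))
    (B : StarAlgBundle.{w, v} Y) : Continuous (pullback f B).proj :=
  (pullback_total_continuous_iff.1 continuous_id).1

theorem continuous_pullback_lift {Y : Type w} [TopologicalSpace Y] (f : C(X, Y))
    (B : StarAlgBundle.{w, v} Y) :
    Continuous fun p : (pullback f B).Total => (⟨f p.1, p.2⟩ : B.Total) :=
  (pullback_total_continuous_iff.1 continuous_id).2

/-- The pullback of a local frame. -/
def LocalFrame.pullback {Y : Type w} [TopologicalSpace Y] {n : ℕ} {B : StarAlgBundle.{w, v} Y}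
    (L : LocalFrame n B) (f : C(X, Y)) : LocalFrame n (pullback f B) where
  base := f ⁻¹' L.base
  isOpen_base := L.isOpen_base.preimage f.continuous
  coord x := L.coord ⟨f x, x.2⟩
  continuous_coord := by
    exact L.continuous_coord.comp (f := fun p : {p : (StarAlgBundle.pullback f B).Total //
      p.1 ∈ f ⁻¹' L.base} => ⟨⟨f p.1.1, p.1.2⟩, p.2⟩)
      (((continuous_pullback_lift f B).comp continuous_subtype_val).subtype_mk _)
  continuous_symm := by
    refine pullback_total_continuous_iff.2 ⟨by fun_prop, ?_⟩
    exact L.continuous_symm.comp (f := fun q : (f ⁻¹' L.base : Set X) × Mat n =>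
      ((⟨f q.1.1, q.1.2⟩, q.2) : L.base × Mat n)) (by fun_prop)

theorem IsMatrixBundle.pullback {Y : Type w} [TopologicalSpace Y] {n : ℕ}
    {B : StarAlgBundle.{w, v} Y} (hB : B.IsMatrixBundle n) (f : C(X, Y)) :
    (pullback f B).IsMatrixBundle n :=
  isMatrixBundle_of_localFrame (continuous_pullback_proj f B) fun x =>
    let ⟨L, hL⟩ := hB.exists_localFrame (f x)
    ⟨L.pullback f, hL⟩

theorem LocalFrame.continuous_unit {n : ℕ} {B : StarAlgBundle.{u, v} X} (L : LocalFrame n B) :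
    Continuous fun x : L.base => (⟨x, 1⟩ : B.Total) := by
  have := L.continuous_symm.comp (f := fun x : L.base => (x, (1 : Mat n))) (by fun_prop)
  refine this.congr fun x => ?_
  simp

theorem IsMatrixBundle.continuous_unit {n : ℕ} {B : StarAlgBundle.{u, v} X}
    (hB : B.IsMatrixBundle n) : Continuous fun x : X => (⟨x, 1⟩ : B.Total) := by
  rw [continuous_iff_continuousAt]
  intro x
  obtain ⟨L, hx⟩ := hB.exists_localFrame x
  exact (continuousOn_iff_continuous_domRestrict.2 L.continuous_unit).continuousAt
    (L.isOpen_base.mem_nhds hx)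

end StarAlgBundle

/-- The matrix in `M_{kl}(ℂ)` underlying an element of the centralizer bundle. -/
def centralizerVal {k l : ℕ} {h : Fr k l} (b : (centralizerBundle k l).Fiber h) : Mat (k * l) :=
  Subtype.val (p := fun T : Mat (k * l) => T ∈ StarSubalgebra.centralizer ℂ (Set.range h)) b

theorem centralizerBundle_total_continuous_iff {k l : ℕ} {Z : Type*} [TopologicalSpace Z]
    {g : Z → (centralizerBundle k l).Total} :
    Continuous g ↔ Continuous (fun z => (g z).1) ∧
      Continuous (fun z => centralizerVal (g z).2) :=
  continuous_induced_rng.trans continuous_prodMk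

/-- Continuous corner isometries give local frames of the bundle of centralizers. -/
theorem isMatrixBundle_centralizerBundle (k l : ℕ) (hk : 0 < k) :
    (centralizerBundle k l).IsMatrixBundle l := by
  obtain ⟨h1, h2⟩ := centralizerBundle_total_continuous_iff.1
    (continuous_id (X := (centralizerBundle k l).Total))
  refine StarAlgBundle.isMatrixBundle_of_localFrame h1 fun h₀ => ?_
  let i : Fin k := ⟨0, hk⟩
  obtain ⟨U, V, hU, hmem, hVc, hV⟩ := exists_continuousOn_isCornerIsometry i h₀
  have hVc' : Continuous fun h : U => V h := continuousOn_iff_continuous_domRestrict.1 hVc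
  refine ⟨⟨U, hU, fun h => (hV h h.2).starAlgEquiv, ?_, ?_⟩, hmem⟩
  · have h3 : Continuous fun p : {p : (centralizerBundle k l).Total // p.1 ∈ U} => V p.1.1 :=
      hVc'.comp (f := fun p : {p : (centralizerBundle k l).Total // p.1 ∈ U} =>
        (⟨p.1.1, p.2⟩ : U)) ((h1.comp continuous_subtype_val).subtype_mk _)
    exact (h3.matrix_conjTranspose.matrix_mul (h2.comp continuous_subtype_val)).matrix_mul h3
  · refine centralizerBundle_total_continuous_iff.2 ⟨by fun_prop, ?_⟩
    have h3 : ∀ T, Continuous fun q : U × Mat l => (q.1 : Fr k l) T := fun T =>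
      (Fr.continuous_apply T).comp (by fun_prop)
    have h4 : Continuous fun q : U × Mat l => V q.1 := hVc'.comp continuous_fst
    change Continuous fun q : U × Mat l => unitCoeff (q.1 : Fr k l) i i (V q.1 * q.2 * (V q.1)ᴴ)
    simp only [unitCoeff_apply]
    refine continuous_finsetSum _ fun m _ => ?_
    exact ((h3 _).mul ((h4.matrix_mul continuous_snd).matrix_mul h4.matrix_conjTranspose)).mul
      (h3 _)

/-! ### The projective unitary group as the automorphism group of `M_n(ℂ)` -/

namespace PU

variable {n : ℕ}

theorem conj_mk (z : Matrix.unitaryGroup (Fin n) ℂ) (T : Mat n) :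
    PU.conj n (QuotientGroup.mk z) T = z * T * star (z : Mat n) := rfl

theorem conj_injective : Function.Injective (PU.conj n) := by
  rw [injective_iff_map_eq_one]
  rintro ⟨z⟩ hz
  refine (QuotientGroup.eq_one_iff z).2 (Subgroup.mem_center_iff.2 fun g => ?_)
  have h1 : (z : Mat n) * g * star (z : Mat n) = g := DFunLike.congr_fun hz (g : Mat n)
  refine Subtype.ext ?_
  change (g : Mat n) * z = z * g
  calc (g : Mat n) * z = z * g * star (z : Mat n) * z := by rw [h1]
    _ = z * g := by rw [mul_assoc, Unitary.star_mul_self_of_mem z.2, mul_one]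

/-- Every `*`-automorphism `φ` of `M_n(ℂ)` is inner: it is implemented by the unitary whose columns
are `φ(E_p0) v`, where `v` is a unit vector spanning the range of `φ(E_00)`. -/
theorem conj_surjective : Function.Surjective (PU.conj n) := by
  intro φ
  rcases Nat.eq_zero_or_pos n with rfl | hn
  · exact ⟨1, by ext T a; exact a.elim0⟩
  let i : Fin n := ⟨0, hn⟩
  let h : Mat n →⋆ₐ[ℂ] Mat n := φ
  obtain ⟨V, hV⟩ := exists_isCornerIsometry (mul_one n).symm h i
  let z : Mat n := Matrix.of fun a p => (h (single p i 1) * V) a 0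
  have hz : ∀ p q, Vᴴ * h (single i p 1) * (h (single q i 1) * V) = if p = q then 1 else 0 := by
    intro p q
    rw [Matrix.mul_assoc, ← Matrix.mul_assoc (h _), ← map_mul]
    split_ifs with hpq
    · rw [hpq, single_mul_single_same, mul_one, hV.proj_mul, hV.isometry]
    · rw [single_mul_single_of_ne _ _ _ _ hpq]
      simp
  have hzz : star z * z = 1 := by
    ext p q
    have h3 := congrFun (congrFun (hz p q) 0) 0
    rw [← conjTranspose_starHom_single, ← conjTranspose_mul, Matrix.mul_apply] at h3
    rw [Matrix.mul_apply, star_eq_conjTranspose]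
    refine Eq.trans ?_ (h3.trans ?_)
    · rfl
    · rw [one_apply]
      split_ifs <;> simp
  have hmem : z ∈ Matrix.unitaryGroup (Fin n) ℂ := mem_unitaryGroup_iff'.2 hzz
  have hzT : ∀ T, z * T = h T * z := by
    intro T
    ext a q
    have h4 : (h T * z) a q = (h T * (h (single q i 1) * V)) a 0 := by
      simp only [Matrix.mul_apply, z, Matrix.of_apply]
    rw [h4, ← Matrix.mul_assoc, ← map_mul, mul_single_eq_sum, map_sum, Matrix.sum_mul,
      Matrix.sum_apply, Matrix.mul_apply]
    refine Finset.sum_congr rfl fun p _ => ?_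
    rw [map_smul, Matrix.smul_mul, Matrix.smul_apply, smul_eq_mul, mul_comm]
    rfl
  refine ⟨QuotientGroup.mk ⟨z, hmem⟩, ?_⟩
  ext1 T
  rw [conj_mk]
  change z * T * star z = h T
  rw [hzT, mul_assoc, mem_unitaryGroup_iff.1 hmem, mul_one]

/-- The isomorphism `PU(n) ≅ Aut(M_n(ℂ))`. -/
def conjEquiv (n : ℕ) : PU n ≃* (Mat n ≃⋆ₐ[ℂ] Mat n) :=
  MulEquiv.ofBijective (PU.conj n) ⟨conj_injective, conj_surjective⟩

@[simp] theorem conj_conjEquiv_symm (φ : Mat n ≃⋆ₐ[ℂ] Mat n) :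
    PU.conj n ((conjEquiv n).symm φ) = φ := (conjEquiv n).apply_symm_apply φ

end PU

theorem isCompact_unitaryGroup (n : ℕ) :
    IsCompact (Matrix.unitaryGroup (Fin n) ℂ : Set (Mat n)) := by
  have hK : IsCompact (Set.univ.pi fun _ : Fin n => Set.univ.pi fun _ : Fin n =>
      Metric.closedBall (0 : ℂ) 1) :=
    isCompact_univ_pi fun _ => isCompact_univ_pi fun _ => isCompact_closedBall _ _
  refine hK.of_isClosed_subset ?_ ?_
  · have : (Matrix.unitaryGroup (Fin n) ℂ : Set (Mat n)) = {z | z * star z = 1} := by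
      ext z
      exact mem_unitaryGroup_iff
    rw [this]
    exact isClosed_eq (continuous_id.matrix_mul continuous_id.matrix_conjTranspose)
      continuous_const
  · intro z hz i _ j _
    rw [mem_closedBall_zero_iff]
    exact entry_norm_bound_of_unitary hz i j

instance (n : ℕ) : CompactSpace (Matrix.unitaryGroup (Fin n) ℂ) :=
  isCompact_iff_compactSpace.1 (isCompact_unitaryGroup n)

instance (n : ℕ) : IsTopologicalGroup (Matrix.unitaryGroup (Fin n) ℂ) :=
  inferInstanceAs (IsTopologicalGroup (unitary (Mat n)))

namespace PU

variable {n : ℕ}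

theorem continuous_conj_apply (T : Mat n) : Continuous fun a : PU n => PU.conj n a T := by
  refine QuotientGroup.isOpenQuotientMap_mk.isQuotientMap.continuous_iff.2 ?_
  have : Continuous fun z : Matrix.unitaryGroup (Fin n) ℂ =>
      (z : Mat n) * T * (z : Mat n)ᴴ :=
    (continuous_subtype_val.mul continuous_const).mul
      continuous_subtype_val.matrix_conjTranspose
  exact this

/-- `PU(n)` carries the topology of pointwise convergence on `M_n(ℂ)`, because it is compact. -/
theorem isClosedEmbedding_conj :
    Topology.IsClosedEmbedding fun (a : PU n) (T : Mat n) => PU.conj n a T := by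
  refine Continuous.isClosedEmbedding (continuous_pi continuous_conj_apply) fun a b hab => ?_
  exact conj_injective (by ext1 T; exact congrFun hab T)

theorem continuous_iff_conj {Z : Type*} [TopologicalSpace Z] {a : Z → PU n} :
    Continuous a ↔ ∀ T, Continuous fun z => PU.conj n (a z) T :=
  isClosedEmbedding_conj.isInducing.continuous_iff.trans continuous_pi_iff

theorem continuous_conj : Continuous fun q : PU n × Mat n => PU.conj n q.1 q.2 := by
  have : ∀ q : PU n × Mat n, PU.conj n q.1 q.2 =
      ∑ i, ∑ j, q.2 i j • PU.conj n q.1 (single i j 1) := fun q =>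
    starHom_eq_sum (PU.conj n q.1 : Mat n →⋆ₐ[ℂ] Mat n) q.2
  simp only [this]
  refine continuous_finsetSum _ fun i _ => continuous_finsetSum _ fun j _ => ?_
  have h1 : Continuous fun q : PU n × Mat n => q.2 i j := by fun_prop
  exact h1.smul ((continuous_conj_apply _).comp continuous_fst)

end PU

/-! ### Maps into Milnor's infinite join -/

namespace MilnorE

variable {G : Type u}

/-- Points of `EG` can be compared through the statements `g i = some a`, which avoids a separate
treatment of positions of weight `0`. -/
theorem ext_some {e e' : MilnorE G} (ht : ∀ i, e.t i = e'.t i)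
    (hg : ∀ i a, e.g i = some a ↔ e'.g i = some a) : e = e' :=
  MilnorE.ext (Finsupp.ext ht) (funext fun i => Option.ext (hg i))

theorem exists_t_ne_zero (e : MilnorE G) : ∃ i, e.t i ≠ 0 := by
  by_contra! h
  have h0 : e.t = 0 := Finsupp.ext h
  have := e.sum_eq_one
  simp [h0] at this

theorem exists_g_eq_some (e : MilnorE G) : ∃ i a, e.g i = some a := by
  obtain ⟨i, hi⟩ := e.exists_t_ne_zero
  exact ⟨i, Option.ne_none_iff_exists'.1 (mt (e.g_eq_none_iff i).1 hi)⟩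

section Topology

variable [TopologicalSpace G]

theorem continuous_iff {Z : Type*} [TopologicalSpace Z] {f : Z → MilnorE G} :
    Continuous f ↔ (∀ i, Continuous fun z => (f z).t i) ∧
      ∀ i (V : Set G), IsOpen V → IsOpen {z | ∃ a ∈ V, (f z).g i = some a} := by
  refine (continuous_inf_rng (f := f)
    (t₂ := ⨅ i : ℕ, TopologicalSpace.induced (fun e : MilnorE G => e.t i) inferInstance)
    (t₃ := TopologicalSpace.generateFrom
      {S | ∃ (i : ℕ) (V : Set G), IsOpen V ∧ S = {e | ∃ a ∈ V, e.g i = some a}})).trans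
    (and_congr ?_ ?_)
  · exact continuous_iInf_rng.trans (forall_congr' fun i => continuous_induced_rng)
  · rw [continuous_generateFrom_iff]
    constructor
    · intro h i V hV
      exact h _ ⟨i, V, hV, rfl⟩
    · rintro h _ ⟨i, V, hV, rfl⟩
      exact h i V hV

end Topology

section Action

variable [Group G]

theorem smul_g (a : G) (e : MilnorE G) (i : ℕ) : (a • e).g i = (e.g i).map (a * ·) := rfl

theorem smul_g_eq_some_iff (a b : G) (e : MilnorE G) (i : ℕ) :
    (a • e).g i = some b ↔ e.g i = some (a⁻¹ * b) := by
  rw [smul_g, Option.map_eq_some_iff]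
  constructor
  · rintro ⟨c, hc, rfl⟩
    simpa using hc
  · intro h
    exact ⟨_, h, by simp⟩

/-- The translation function `(a • e, e) ↦ a` of the free action on `EG` is continuous. -/
theorem continuous_of_smul_eq [TopologicalSpace G] [IsTopologicalGroup G] {Z : Type*}
    [TopologicalSpace Z] {f f' : Z → MilnorE G} (hf : Continuous f) (hf' : Continuous f')
    {a : Z → G} (h : ∀ z, f z = a z • f' z) : Continuous a := by
  rw [continuous_iff_continuousAt]
  intro z W hW
  obtain ⟨i, b, hb⟩ := (f' z).exists_g_eq_some
  have hdiv : Filter.Tendsto (fun p : G × G => p.1 * p.2⁻¹) (nhds (a z * b, b)) (nhds (a z)) := by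
    have : Continuous fun p : G × G => p.1 * p.2⁻¹ := by fun_prop
    simpa using this.tendsto (a z * b, b)
  obtain ⟨V, V', hV, hbV, hV', hbV', hVV⟩ := mem_nhds_prod_iff'.1 (hdiv hW)
  have h1 := (continuous_iff.1 hf).2 i V hV
  have h2 := (continuous_iff.1 hf').2 i V' hV'
  rw [Filter.mem_map]
  refine Filter.mem_of_superset ((h1.inter h2).mem_nhds ⟨⟨a z * b, hbV, ?_⟩, b, hbV', hb⟩) ?_
  · rw [h, smul_g, hb]
    rfl
  · rintro y ⟨⟨c, hc, hc'⟩, d, hd, hd'⟩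
    rw [h, smul_g, hd', Option.map_some, Option.some_inj] at hc'
    have := hVV (Set.mk_mem_prod hc hd)
    simpa [← hc'] using this

end Action

/-! ### Homotopies in Milnor's infinite join -/

/-- The weights `u i * e.t i`, moved from position `i` to position `σ i`. -/
def pushWeight (σ : ℕ ↪ ℕ) (u : ℕ → ℝ) (e : MilnorE G) : ℕ →₀ ℝ :=
  Finsupp.embDomain σ (Finsupp.onFinset e.t.support (fun i => u i * e.t i) fun i hi => by
    rw [Finsupp.mem_support_iff]
    exact right_ne_zero_of_mul hi)

theorem pushWeight_apply (σ : ℕ ↪ ℕ) (u : ℕ → ℝ) (e : MilnorE G) (i : ℕ) :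
    pushWeight σ u e (σ i) = u i * e.t i := by
  rw [pushWeight, Finsupp.embDomain_apply_self]
  rfl

theorem pushWeight_of_notMem (σ : ℕ ↪ ℕ) (u : ℕ → ℝ) (e : MilnorE G) {m : ℕ}
    (hm : m ∉ Set.range σ) : pushWeight σ u e m = 0 :=
  Finsupp.embDomain_of_notMem_range _ _ _ hm

theorem pushWeight_nonneg (σ : ℕ ↪ ℕ) {u : ℕ → ℝ} (hu : ∀ i, 0 ≤ u i) (e : MilnorE G) (m : ℕ) :
    0 ≤ pushWeight σ u e m := by
  by_cases hm : m ∈ Set.range σ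
  · obtain ⟨i, rfl⟩ := hm
    rw [pushWeight_apply]
    exact mul_nonneg (hu i) (e.nonneg i)
  · rw [pushWeight_of_notMem σ u e hm]

theorem sum_pushWeight (σ : ℕ ↪ ℕ) (u : ℕ → ℝ) (e : MilnorE G) :
    ((pushWeight σ u e).sum fun _ r => r) = ∑ i ∈ e.t.support, u i * e.t i := by
  rw [pushWeight, Finsupp.sum_embDomain, Finsupp.onFinset_sum _ (fun _ => rfl)]

theorem pushWeight_ne_zero_iff (σ : ℕ ↪ ℕ) (u : ℕ → ℝ) (e : MilnorE G) (m : ℕ) :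
    pushWeight σ u e m ≠ 0 ↔ ∃ i, σ i = m ∧ u i ≠ 0 ∧ e.t i ≠ 0 := by
  constructor
  · intro h
    by_cases hm : m ∈ Set.range σ
    · obtain ⟨i, rfl⟩ := hm
      rw [pushWeight_apply] at h
      exact ⟨i, rfl, left_ne_zero_of_mul h, right_ne_zero_of_mul h⟩
    · exact absurd (pushWeight_of_notMem σ u e hm) h
  · rintro ⟨i, rfl, h1, h2⟩
    rw [pushWeight_apply]
    exact mul_ne_zero h1 h2

/-- The conditions under which the two points `e`, `e'` of `EG`, with their weights rescaled by
`u`, `v` and moved to other positions by `σ`, `τ`, can be added: the total weight is `1`, and where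
positions of positive weight collide the group elements agree. -/
structure IsMixable (σ τ : ℕ ↪ ℕ) (u v : ℕ → ℝ) (e e' : MilnorE G) : Prop where
  left_nonneg : ∀ i, 0 ≤ u i
  right_nonneg : ∀ i, 0 ≤ v i
  sum_eq_one : ∑ i ∈ e.t.support, u i * e.t i + ∑ i ∈ e'.t.support, v i * e'.t i = 1
  compatible : ∀ i j, σ i = τ j → u i ≠ 0 → v j ≠ 0 → e.g i = e'.g j

open Classical in
/-- The sum of the points `e` and `e'` of `EG`, with their weights rescaled by `u`, `v` and moved to
other positions by `σ`, `τ`. -/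
def mix (σ τ : ℕ ↪ ℕ) (u v : ℕ → ℝ) (e e' : MilnorE G) (h : IsMixable σ τ u v e e') :
    MilnorE G where
  t := pushWeight σ u e + pushWeight τ v e'
  g m := if pushWeight σ u e m ≠ 0 then Function.extend σ e.g (fun _ => none) m else
    if pushWeight τ v e' m ≠ 0 then Function.extend τ e'.g (fun _ => none) m else none
  nonneg m := add_nonneg (pushWeight_nonneg σ h.left_nonneg e m)
    (pushWeight_nonneg τ h.right_nonneg e' m)
  sum_eq_one := by
    rw [Finsupp.sum_add_index' (fun _ => rfl) (fun _ _ _ => rfl), sum_pushWeight, sum_pushWeight,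
      h.sum_eq_one]
  g_eq_none_iff m := by
    have h1 := pushWeight_nonneg σ h.left_nonneg e m
    have h2 := pushWeight_nonneg τ h.right_nonneg e' m
    rw [Finsupp.add_apply, add_eq_zero_iff_of_nonneg h1 h2]
    split_ifs with h3 h4
    · obtain ⟨i, rfl, -, hi⟩ := (pushWeight_ne_zero_iff σ u e m).1 h3
      rw [σ.injective.extend_apply, e.g_eq_none_iff]
      exact iff_of_false hi fun h => h3 h.1
    · obtain ⟨i, rfl, -, hi⟩ := (pushWeight_ne_zero_iff τ v e' m).1 h4
      rw [τ.injective.extend_apply, e'.g_eq_none_iff]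
      exact iff_of_false hi fun h => h4 h.2
    · push Not at h3 h4
      exact iff_of_true rfl ⟨h3, h4⟩

theorem mix_t {σ τ : ℕ ↪ ℕ} {u v : ℕ → ℝ} {e e' : MilnorE G} (h : IsMixable σ τ u v e e') (m : ℕ) :
    (mix σ τ u v e e' h).t m = pushWeight σ u e m + pushWeight τ v e' m := rfl

theorem mix_g_eq_some_iff {σ τ : ℕ ↪ ℕ} {u v : ℕ → ℝ} {e e' : MilnorE G}
    (h : IsMixable σ τ u v e e') (m : ℕ) (a : G) :
    (mix σ τ u v e e' h).g m = some a ↔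
      (∃ i, σ i = m ∧ u i ≠ 0 ∧ e.g i = some a) ∨ (∃ i, τ i = m ∧ v i ≠ 0 ∧ e'.g i = some a) := by
  have ht : ∀ (e : MilnorE G) i, e.g i = some a → e.t i ≠ 0 := by
    intro e i hi h0
    rw [(e.g_eq_none_iff i).2 h0] at hi
    exact Option.some_ne_none a hi.symm
  simp only [mix]
  split_ifs with h3 h4
  · obtain ⟨i, rfl, hu, -⟩ := (pushWeight_ne_zero_iff σ u e m).1 h3
    rw [σ.injective.extend_apply]
    constructor
    · exact fun hi => Or.inl ⟨i, rfl, hu, hi⟩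
    · rintro (⟨j, hj, -, hj'⟩ | ⟨j, hj, hv, hj'⟩)
      · rwa [← σ.injective hj]
      · rw [h.compatible i j hj.symm hu hv, hj']
  · obtain ⟨i, rfl, hv, -⟩ := (pushWeight_ne_zero_iff τ v e' m).1 h4
    rw [τ.injective.extend_apply]
    constructor
    · exact fun hi => Or.inr ⟨i, rfl, hv, hi⟩
    · rintro (⟨j, hj, hu, hj'⟩ | ⟨j, hj, -, hj'⟩)
      · exact absurd ((pushWeight_ne_zero_iff σ u e _).2 ⟨j, hj, hu, ht e j hj'⟩) h3
      · rwa [← τ.injective hj]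
  · refine iff_of_false (by simp) ?_
    rintro (⟨j, hj, hu, hj'⟩ | ⟨j, hj, hv, hj'⟩)
    · exact h3 ((pushWeight_ne_zero_iff σ u e _).2 ⟨j, hj, hu, ht e j hj'⟩)
    · exact h4 ((pushWeight_ne_zero_iff τ v e' _).2 ⟨j, hj, hv, ht e' j hj'⟩)

theorem IsMixable.smul [Group G] {σ τ : ℕ ↪ ℕ} {u v : ℕ → ℝ} {e e' : MilnorE G}
    (h : IsMixable σ τ u v e e') (a : G) : IsMixable σ τ u v (a • e) (a • e') :=
  ⟨h.1, h.2, h.3, fun i j hij hu hv => congrArg (Option.map (a * ·)) (h.compatible i j hij hu hv)⟩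

theorem mix_smul [Group G] {σ τ : ℕ ↪ ℕ} {u v : ℕ → ℝ} {e e' : MilnorE G}
    (h : IsMixable σ τ u v e e') (a : G) (h' : IsMixable σ τ u v (a • e) (a • e')) :
    mix σ τ u v (a • e) (a • e') h' = a • mix σ τ u v e e' h := by
  refine ext_some (fun m => rfl) fun m b => ?_
  rw [smul_g_eq_some_iff, mix_g_eq_some_iff, mix_g_eq_some_iff]
  simp only [smul_g_eq_some_iff]

theorem continuous_mix [TopologicalSpace G] {Z : Type*} [TopologicalSpace Z] {σ τ : ℕ ↪ ℕ}
    {u v : Z → ℕ → ℝ} {f f' : Z → MilnorE G} (h : ∀ z, IsMixable σ τ (u z) (v z) (f z) (f' z))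
    (hu : ∀ i, Continuous fun z => u z i) (hv : ∀ i, Continuous fun z => v z i)
    (hf : Continuous f) (hf' : Continuous f') :
    Continuous fun z => mix σ τ (u z) (v z) (f z) (f' z) (h z) := by
  rw [continuous_iff] at hf hf' ⊢
  have hw : ∀ {f : Z → MilnorE G} {u : Z → ℕ → ℝ} (σ : ℕ ↪ ℕ)
      (_ : ∀ i, Continuous fun z => (f z).t i) (_ : ∀ i, Continuous fun z => u z i) (m : ℕ),
      Continuous fun z => pushWeight σ (u z) (f z) m := by
    intro f u σ hf hu m
    by_cases hm : m ∈ Set.range σ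
    · obtain ⟨i, rfl⟩ := hm
      simp only [pushWeight_apply]
      exact (hu i).mul (hf i)
    · simp only [pushWeight_of_notMem σ _ _ hm]
      exact continuous_const
  refine ⟨fun m => (hw σ hf.1 hu m).add (hw τ hf'.1 hv m), fun m V hV => ?_⟩
  have : {z | ∃ a ∈ V, (mix σ τ (u z) (v z) (f z) (f' z) (h z)).g m = some a} =
      (⋃ i, {z | σ i = m} ∩ ({z | u z i ≠ 0} ∩ {z | ∃ a ∈ V, (f z).g i = some a})) ∪
      ⋃ i, {z | τ i = m} ∩ ({z | v z i ≠ 0} ∩ {z | ∃ a ∈ V, (f' z).g i = some a}) := by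
    ext z
    simp only [mix_g_eq_some_iff, Set.mem_ofPred_eq, Set.mem_union, Set.mem_iUnion,
      Set.mem_inter_iff]
    constructor
    · rintro ⟨a, ha, ⟨i, h1, h2, h3⟩ | ⟨i, h1, h2, h3⟩⟩
      · exact Or.inl ⟨i, h1, h2, a, ha, h3⟩
      · exact Or.inr ⟨i, h1, h2, a, ha, h3⟩
    · rintro (⟨i, h1, h2, a, ha, h3⟩ | ⟨i, h1, h2, a, ha, h3⟩)
      · exact ⟨a, ha, Or.inl ⟨i, h1, h2, h3⟩⟩
      · exact ⟨a, ha, Or.inr ⟨i, h1, h2, h3⟩⟩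
  rw [this]
  refine IsOpen.union (isOpen_iUnion fun i => ?_) (isOpen_iUnion fun i => ?_)
  · exact isOpen_const.inter ((isOpen_ne_fun (hu i) continuous_const).inter (hf.2 i V hV))
  · exact isOpen_const.inter ((isOpen_ne_fun (hv i) continuous_const).inter (hf'.2 i V hV))

theorem sum_support_t (e : MilnorE G) : ∑ i ∈ e.t.support, e.t i = 1 := e.sum_eq_one

/-- The fraction of the weight at position `i` that is moved at time `s`: the move takes place
while `2⁻⁽ⁱ⁺¹⁾ ≤ s ≤ 2⁻ⁱ`, so that higher positions are moved earlier, and each position stays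
at rest for small `s`. -/
def moveFraction (s : ℝ) (i : ℕ) : ℝ := max 0 (min 1 (2 ^ (i + 1) * s - 1))

theorem moveFraction_nonneg (s : ℝ) (i : ℕ) : 0 ≤ moveFraction s i := le_max_left _ _

theorem moveFraction_le_one (s : ℝ) (i : ℕ) : moveFraction s i ≤ 1 :=
  max_le zero_le_one (min_le_left _ _)

@[simp] theorem moveFraction_zero (i : ℕ) : moveFraction 0 i = 0 := by
  simp [moveFraction]

@[simp] theorem moveFraction_one (i : ℕ) : moveFraction 1 i = 1 := by
  have : (2 : ℝ) ≤ 2 ^ (i + 1) := le_self_pow₀ one_le_two (by omega)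
  rw [moveFraction, min_eq_left (by linarith), max_eq_right zero_le_one]

theorem continuous_moveFraction (i : ℕ) : Continuous fun s => moveFraction s i := by
  unfold moveFraction
  fun_prop

/-- Once position `i` has begun to move, all higher positions have been vacated. -/
theorem moveFraction_eq_one_of_lt {s : ℝ} {i j : ℕ} (hij : i < j) (hi : moveFraction s i ≠ 0) :
    moveFraction s j = 1 := by
  have h1 : 1 < 2 ^ (i + 1) * s := by
    by_contra! h
    exact hi (max_eq_left ((min_le_right _ _).trans (by linarith)))
  have hs : 0 ≤ s := by
    by_contra! h
    have := mul_neg_of_pos_of_neg (show (0 : ℝ) < 2 ^ (i + 1) by positivity) h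
    linarith
  have h2 : (2 : ℝ) ^ (i + 1) * s ≤ 2 ^ j * s :=
    mul_le_mul_of_nonneg_right (pow_le_pow_right₀ one_le_two hij) hs
  rw [moveFraction, min_eq_left (by rw [pow_succ]; linarith), max_eq_right zero_le_one]

theorem isMixable_spread {τ : ℕ ↪ ℕ} (hτ : StrictMono τ) (s : ℝ) (e : MilnorE G) :
    IsMixable (Function.Embedding.refl ℕ) τ (fun i => 1 - moveFraction s i) (moveFraction s)
      e e where
  left_nonneg i := sub_nonneg.2 (moveFraction_le_one s i)
  right_nonneg := moveFraction_nonneg s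
  sum_eq_one := by
    rw [← Finset.sum_add_distrib]
    exact (Finset.sum_congr rfl fun i _ => by ring).trans e.sum_support_t
  compatible i j hij hu hv := by
    have hij' : i = τ j := hij
    rcases (hτ.le_apply (x := j)).eq_or_lt with h | h
    · rw [hij', ← h]
    -- otherwise position `j` would move to `τ j > j` before that position is vacated
    · exact absurd (by rw [hij', moveFraction_eq_one_of_lt h hv, sub_self]) hu

/-- A homotopy from the identity of `EG` to the map that moves position `i` to position `τ i`, where
`τ` is strictly increasing. -/
def spread {τ : ℕ ↪ ℕ} (hτ : StrictMono τ) (s : ℝ) (e : MilnorE G) : MilnorE G :=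
  mix _ τ _ _ e e (isMixable_spread hτ s e)

theorem isMixable_join {σ τ : ℕ ↪ ℕ} (hστ : ∀ i j, σ i ≠ τ j) {s : ℝ} (hs : s ∈ unitInterval)
    (e e' : MilnorE G) : IsMixable σ τ (fun _ => 1 - s) (fun _ => s) e e' where
  left_nonneg _ := sub_nonneg.2 hs.2
  right_nonneg _ := hs.1
  sum_eq_one := by
    rw [← Finset.mul_sum, ← Finset.mul_sum, e.sum_support_t, e'.sum_support_t]
    ring
  compatible i j hij := absurd hij (hστ i j)

/-- The segment between `e` and `e'` after these points have been moved to disjoint positions. -/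
def join {σ τ : ℕ ↪ ℕ} (hστ : ∀ i j, σ i ≠ τ j) (s : unitInterval) (e e' : MilnorE G) :
    MilnorE G :=
  mix σ τ _ _ e e' (isMixable_join hστ s.2 e e')

theorem pushWeight_eq_zero (σ : ℕ ↪ ℕ) (u : ℕ → ℝ) (hu : ∀ i, u i = 0) (e : MilnorE G) (m : ℕ) :
    pushWeight σ u e m = 0 := by
  by_contra h
  obtain ⟨i, -, hi, -⟩ := (pushWeight_ne_zero_iff σ u e m).1 h
  exact hi (hu i)

theorem pushWeight_congr (σ : ℕ ↪ ℕ) {u v : ℕ → ℝ} (h : ∀ i, u i = v i) (e : MilnorE G) :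
    pushWeight σ u e = pushWeight σ v e := by
  rw [funext h]

@[simp] theorem spread_zero {τ : ℕ ↪ ℕ} (hτ : StrictMono τ) (e : MilnorE G) :
    spread hτ 0 e = e := by
  refine ext_some (fun m => ?_) fun m a => ?_
  · rw [spread, mix_t, pushWeight_eq_zero τ _ moveFraction_zero, add_zero]
    exact (pushWeight_apply (Function.Embedding.refl ℕ) _ e m).trans (by simp)
  · rw [spread, mix_g_eq_some_iff]
    simp

theorem spread_one_eq_join_zero {σ τ : ℕ ↪ ℕ} (hσ : StrictMono σ) (hστ : ∀ i j, σ i ≠ τ j)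
    (e e' : MilnorE G) : spread hσ 1 e = join hστ 0 e e' := by
  refine ext_some (fun m => ?_) fun m a => ?_
  · rw [spread, join, mix_t, mix_t, pushWeight_eq_zero _ _ (by simp),
      pushWeight_eq_zero τ _ (by simp), zero_add, add_zero]
    congr 1
    exact pushWeight_congr _ (by simp) _
  · rw [spread, join, mix_g_eq_some_iff, mix_g_eq_some_iff]
    simp

theorem spread_one_eq_join_one {σ τ : ℕ ↪ ℕ} (hτ : StrictMono τ) (hστ : ∀ i j, σ i ≠ τ j)
    (e e' : MilnorE G) : spread hτ 1 e' = join hστ 1 e e' := by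
  refine ext_some (fun m => ?_) fun m a => ?_
  · rw [spread, join, mix_t, mix_t, pushWeight_eq_zero _ _ (by simp),
      pushWeight_eq_zero σ _ (by simp), zero_add, zero_add]
    congr 1
    exact pushWeight_congr _ (by simp) _
  · rw [spread, join, mix_g_eq_some_iff, mix_g_eq_some_iff]
    simp

theorem spread_smul [Group G] {τ : ℕ ↪ ℕ} (hτ : StrictMono τ) (s : ℝ) (a : G) (e : MilnorE G) :
    spread hτ s (a • e) = a • spread hτ s e := mix_smul _ _ _

theorem join_smul [Group G] {σ τ : ℕ ↪ ℕ} (hστ : ∀ i j, σ i ≠ τ j) (s : unitInterval) (a : G)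
    (e e' : MilnorE G) : join hστ s (a • e) (a • e') = a • join hστ s e e' := mix_smul _ _ _

theorem continuous_spread [TopologicalSpace G] {τ : ℕ ↪ ℕ} (hτ : StrictMono τ) {Z : Type*}
    [TopologicalSpace Z] {s : Z → ℝ} {f : Z → MilnorE G} (hs : Continuous s) (hf : Continuous f) :
    Continuous fun z => spread hτ (s z) (f z) :=
  continuous_mix (fun z => isMixable_spread hτ (s z) (f z))
    (fun i => continuous_const.sub ((continuous_moveFraction i).comp hs))
    (fun i => (continuous_moveFraction i).comp hs) hf hf

theorem continuous_join [TopologicalSpace G] {σ τ : ℕ ↪ ℕ} (hστ : ∀ i j, σ i ≠ τ j) {Z : Type*}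
    [TopologicalSpace Z] {s : Z → unitInterval} {f f' : Z → MilnorE G} (hs : Continuous s)
    (hf : Continuous f) (hf' : Continuous f') : Continuous fun z => join hστ (s z) (f z) (f' z) :=
  continuous_mix (fun z => isMixable_join hστ (s z).2 (f z) (f' z))
    (fun _ => continuous_const.sub (continuous_subtype_val.comp hs))
    (fun _ => continuous_subtype_val.comp hs) hf hf'

end MilnorE

/-! ### Frames -/

namespace StarAlgBundle

variable {X : Type u}

namespace Frame

variable {l : ℕ} {B : StarAlgBundle.{u, v} X}

theorem continuous_iff {Z : Type*} [TopologicalSpace Z] {g : Z → Frame l B} :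
    Continuous g ↔ ∀ T, Continuous fun z => (⟨(g z).base, (g z).iso T⟩ : B.Total) :=
  continuous_induced_rng.trans continuous_pi_iff

theorem continuous_iso_apply (T : Mat l) :
    Continuous fun j : Frame l B => (⟨j.base, j.iso T⟩ : B.Total) :=
  continuous_iff.1 continuous_id T

theorem continuous_base [TopologicalSpace X] (hp : Continuous B.proj) :
    Continuous fun j : Frame l B => j.base :=
  hp.comp (continuous_iso_apply 0)

/-- `PU(l)` acts transitively on the frames over a point. -/
theorem exists_act_eq {x : X} (i i' : Mat l ≃⋆ₐ[ℂ] B.Fiber x) :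
    ∃ a : PU l, (⟨x, i'⟩ : Frame l B) = Frame.act ⟨x, i⟩ a := by
  refine ⟨(PU.conjEquiv l).symm (i'.trans i.symm), ?_⟩
  simp only [act, PU.conj_conjEquiv_symm]
  congr 1
  ext1 T
  simp

end Frame

variable [TopologicalSpace X]

namespace LocalFrame

variable {l : ℕ} {B : StarAlgBundle.{u, v} X} (L : LocalFrame l B)

/-- The section of the bundle of frames given by a local frame. -/
def frame (x : L.base) : Frame l B := ⟨x, (L.coord x).symm⟩

theorem continuous_frame : Continuous L.frame :=
  Frame.continuous_iff.2 fun T => L.continuous_symm.comp (f := fun x => (x, T)) (by fun_prop)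

/-- The element of `PU(l)` by which a frame differs from a given local frame. -/
def transition (j : {j : Frame l B // j.base ∈ L.base}) : PU l :=
  (PU.conjEquiv l).symm (j.1.iso.trans (L.coord ⟨j.1.base, j.2⟩))

theorem continuous_transition : Continuous L.transition := by
  refine PU.continuous_iff_conj.2 fun T => ?_
  simp only [transition, PU.conj_conjEquiv_symm]
  exact L.continuous_coord.comp (f := fun j : {j : Frame l B // j.base ∈ L.base} =>
    (⟨⟨j.1.base, j.1.iso T⟩, j.2⟩ : {p : B.Total // p.1 ∈ L.base}))
    (((Frame.continuous_iso_apply T).comp continuous_subtype_val).subtype_mk _)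

theorem transition_act (j : {j : Frame l B // j.base ∈ L.base}) (a : PU l) :
    L.transition ⟨j.1.act a, j.2⟩ = L.transition j * a := by
  apply PU.conj_injective
  rw [map_mul]
  simp only [transition, PU.conj_conjEquiv_symm]
  rfl

end LocalFrame

theorem IsMatrixBundle.nonempty_frame {l : ℕ} {B : StarAlgBundle.{u, v} X}
    (hB : B.IsMatrixBundle l) (x : X) : Nonempty (Mat l ≃⋆ₐ[ℂ] B.Fiber x) := by
  obtain ⟨L, hx⟩ := hB.exists_localFrame x
  exact ⟨(L.coord ⟨x, hx⟩).symm⟩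

/-! ### Classifying maps -/

theorem quotient_mk_smul {l : ℕ} (a : PU l) (e : EPU l) :
    (Quotient.mk _ (a • e) : BPU l) = Quotient.mk _ e :=
  Quotient.sound ⟨a, rfl⟩

/-- An equivariant family of maps from the bundle of frames to `EPU(l)` descends to a family of
maps to `BPU(l)`. -/
theorem IsMatrixBundle.exists_descend {l : ℕ} {B : StarAlgBundle.{u, v} X}
    (hB : B.IsMatrixBundle l) {Y : Type*} [TopologicalSpace Y] {Ψ : Y × Frame l B → EPU l}
    (hΨ : Continuous Ψ) (hact : ∀ y j (a : PU l), Ψ (y, j.act a) = a⁻¹ • Ψ (y, j)) :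
    ∃ φ : C(Y × X, BPU l), ∀ y (j : Frame l B), φ (y, j.base) = Quotient.mk _ (Ψ (y, j)) := by
  let i := fun x => (hB.nonempty_frame x).some
  let φ : Y × X → BPU l := fun p => Quotient.mk _ (Ψ (p.1, ⟨p.2, i p.2⟩))
  have hφ : ∀ y (j : Frame l B), φ (y, j.base) = Quotient.mk _ (Ψ (y, j)) := by
    rintro y ⟨x, j⟩
    obtain ⟨a, ha⟩ := Frame.exists_act_eq (i x) j
    rw [ha, hact, quotient_mk_smul]
    rfl
  refine ⟨⟨φ, ?_⟩, hφ⟩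
  rw [continuous_iff_continuousAt]
  rintro ⟨y, x⟩
  obtain ⟨L, hx⟩ := hB.exists_localFrame x
  have h1 : Continuous fun p : (Set.univ ×ˢ L.base : Set (Y × X)) =>
      (Quotient.mk _ (Ψ (p.1.1, L.frame ⟨p.1.2, p.2.2⟩)) : BPU l) := by
    refine continuous_quotient_mk'.comp (hΨ.comp (Continuous.prodMk (by fun_prop) ?_))
    exact L.continuous_frame.comp (by fun_prop)
  have h2 : ContinuousOn φ (Set.univ ×ˢ L.base) := by
    rw [continuousOn_iff_continuous_domRestrict]
    exact h1.congr fun p => (hφ p.1.1 (L.frame ⟨p.1.2, p.2.2⟩)).symm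
  exact h2.continuousAt ((isOpen_univ.prod L.isOpen_base).mem_nhds ⟨Set.mem_univ _, hx⟩)

theorem IsMatrixBundle.eq_of_covered {l : ℕ} {B : StarAlgBundle.{u, v} X}
    (hB : B.IsMatrixBundle l) {Y : Type*} {φ φ' : X → Y}
    (h : ∀ j : Frame l B, φ j.base = φ' j.base) (x : X) : φ x = φ' x :=
  h ⟨x, (hB.nonempty_frame x).some⟩

theorem IsMatrixBundle.homotopic_of_equivariant {l : ℕ} {B : StarAlgBundle.{u, v} X}
    (hB : B.IsMatrixBundle l) {Ψ : unitInterval × Frame l B → EPU l}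
    (hΨ : Continuous Ψ) (hact : ∀ y j (a : PU l), Ψ (y, j.act a) = a⁻¹ • Ψ (y, j))
    {φ φ' : C(X, BPU l)} (h0 : ∀ j : Frame l B, φ j.base = Quotient.mk _ (Ψ (0, j)))
    (h1 : ∀ j : Frame l B, φ' j.base = Quotient.mk _ (Ψ (1, j))) : φ.Homotopic φ' := by
  obtain ⟨H, hH⟩ := hB.exists_descend hΨ hact
  refine ⟨⟨H, ?_, ?_⟩⟩
  · exact hB.eq_of_covered (φ := fun x => H (0, x)) fun j => (hH 0 j).trans (h0 j).symm
  · exact hB.eq_of_covered (φ := fun x => H (1, x)) fun j => (hH 1 j).trans (h1 j).symm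

theorem IsMatrixBundle.exists_covered {l : ℕ} {B : StarAlgBundle.{u, v} X}
    (hB : B.IsMatrixBundle l) {Φ : Frame l B → EPU l} (hΦ : Continuous Φ)
    (hact : ∀ j (a : PU l), Φ (j.act a) = a⁻¹ • Φ j) :
    ∃ φ : C(X, BPU l), ∀ j : Frame l B, φ j.base = Quotient.mk _ (Φ j) := by
  obtain ⟨H, hH⟩ := hB.exists_descend (Y := Unit) (Ψ := fun p => Φ p.2)
    (hΦ.comp continuous_snd) fun _ => hact
  exact ⟨H.comp ⟨fun x => ((), x), by fun_prop⟩, fun j => hH () j⟩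

/-- Any two classifying maps of a bundle of matrix algebras, over an arbitrary space, are
homotopic: equivariant maps to `EPU(l)` can be moved to the even and the odd positions of the
infinite join, and are then connected by segments. -/
theorem IsClassifyingMap.homotopic {l : ℕ} {B : StarAlgBundle.{u, v} X}
    (hB : B.IsMatrixBundle l) {φ φ' : C(X, BPU l)} (hφ : B.IsClassifyingMap l φ)
    (hφ' : B.IsClassifyingMap l φ') : φ.Homotopic φ' := by
  obtain ⟨Φ, hc, ha, hm⟩ := hφ
  obtain ⟨Φ', hc', ha', hm'⟩ := hφ'
  let σ : ℕ ↪ ℕ := ⟨fun i => 2 * i, fun i j h => by simpa using h⟩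
  let τ : ℕ ↪ ℕ := ⟨fun i => 2 * i + 1, fun i j h => by simpa using h⟩
  have hσ : StrictMono σ := fun i j h => by change 2 * i < 2 * j; omega
  have hτ : StrictMono τ := fun i j h => by change 2 * i + 1 < 2 * j + 1; omega
  have hστ : ∀ i j, σ i ≠ τ j := fun i j => by change 2 * i ≠ 2 * j + 1; omega
  have hs : Continuous fun p : unitInterval × Frame l B => (p.1 : ℝ) := by fun_prop
  have key : ∀ {Φ : Frame l B → EPU l} {σ : ℕ ↪ ℕ} (hσ : StrictMono σ) {φ ψ : C(X, BPU l)},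
      Continuous Φ → (∀ j (a : PU l), Φ (j.act a) = a⁻¹ • Φ j) →
      (∀ j : Frame l B, φ j.base = Quotient.mk _ (Φ j)) →
      (∀ j : Frame l B, ψ j.base = Quotient.mk _ (MilnorE.spread hσ 1 (Φ j))) →
      φ.Homotopic ψ := by
    intro Φ σ hσ φ ψ hc ha hm hψ
    refine hB.homotopic_of_equivariant (Ψ := fun p => MilnorE.spread hσ p.1 (Φ p.2))
      (MilnorE.continuous_spread hσ (by fun_prop) (by fun_prop)) ?_ ?_ ?_
    · intro s j a
      simp only [ha, MilnorE.spread_smul]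
    · intro j
      simp [hm]
    · intro j
      simp [hψ]
  obtain ⟨ψ, hψ⟩ := hB.exists_covered (Φ := fun j => MilnorE.spread hσ 1 (Φ j))
    (MilnorE.continuous_spread hσ continuous_const hc) fun j a => by
      simp only [ha, MilnorE.spread_smul]
  obtain ⟨ψ', hψ'⟩ := hB.exists_covered (Φ := fun j => MilnorE.spread hτ 1 (Φ' j))
    (MilnorE.continuous_spread hτ continuous_const hc') fun j a => by
      simp only [ha', MilnorE.spread_smul]
  have hjoin : ψ.Homotopic ψ' := by
    refine hB.homotopic_of_equivariant
      (Ψ := fun p => MilnorE.join hστ p.1 (Φ p.2) (Φ' p.2))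
      (MilnorE.continuous_join hστ (by fun_prop) (by fun_prop) (by fun_prop)) ?_ ?_ ?_
    · intro s j a
      simp only [ha, ha', MilnorE.join_smul]
    · intro j
      rw [hψ, MilnorE.spread_one_eq_join_zero hσ hστ _ (Φ' j)]
    · intro j
      rw [hψ', MilnorE.spread_one_eq_join_one hτ hστ (Φ j)]
  exact ((key hσ hc ha hm hψ).trans hjoin).trans (key hτ hc' ha' hm' hψ').symm

/-- Milnor's classifying map: a countable partition of unity subordinate to local frames gives the
weights, and the local frames give the group elements. -/
theorem IsMatrixBundle.exists_isClassifyingMap {l : ℕ} {B : StarAlgBundle.{u, v} X}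
    (hB : B.IsMatrixBundle l) [NormalSpace X] [ParacompactSpace X] [LindelofSpace X] :
    ∃ φ : C(X, BPU l), B.IsClassifyingMap l φ := by
  classical
  suffices h : ∃ Φ : Frame l B → EPU l, Continuous Φ ∧
      ∀ (j : Frame l B) (a : PU l), Φ (j.act a) = a⁻¹ • Φ j by
    obtain ⟨Φ, hc, ha⟩ := h
    obtain ⟨φ, hφ⟩ := hB.exists_covered hc ha
    exact ⟨φ, Φ, hc, ha, hφ⟩
  rcases isEmpty_or_nonempty X with hX | hX
  · exact ⟨fun j => isEmptyElim j.base, continuous_iff_continuousAt.2 fun j => isEmptyElim j.base,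
      fun j => isEmptyElim j.base⟩
  -- countably many local frames suffice, as needed for a join indexed by `ℕ`
  obtain ⟨L, hL⟩ : ∃ L : ℕ → LocalFrame l B, ⋃ n, (L n).base = Set.univ := by
    choose L hL using hB.exists_localFrame
    obtain ⟨t, ht, htU⟩ := LindelofSpace.elim_nhds_subcover (fun x => (L x).base)
      fun x => (L x).isOpen_base.mem_nhds (hL x)
    have hne : t.Nonempty := by
      by_contra h
      rw [Set.not_nonempty_iff_eq_empty] at h
      simp only [h, Set.biUnion_empty] at htU
      exact Set.empty_ne_univ htU
    obtain ⟨c, rfl⟩ := ht.exists_eq_range hne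
    exact ⟨fun n => L (c n), by simpa using htU⟩
  obtain ⟨ρ, hρ⟩ := PartitionOfUnity.exists_isSubordinate isClosed_univ (fun n => (L n).base)
    (fun n => (L n).isOpen_base) hL.ge
  have hmem : ∀ {n x}, ρ n x ≠ 0 → x ∈ (L n).base := fun hx => hρ _ (subset_tsupport _ hx)
  -- the inverse turns the right action on frames into the left action on `EPU(l)`
  let Φ : Frame l B → EPU l := fun j =>
    { t := Finsupp.ofSupportFinite (fun n => ρ n j.base) (ρ.locallyFinite.point_finite j.base)
      g := fun n => if h : ρ n j.base ≠ 0 then some ((L n).transition ⟨j, hmem h⟩)⁻¹ else none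
      nonneg := fun n => ρ.nonneg n _
      sum_eq_one := by
        rw [← ρ.sum_eq_one (Set.mem_univ j.base)]
        rw [finsum_eq_sum _ (ρ.locallyFinite.point_finite j.base)]
        rfl
      g_eq_none_iff := fun n => by
        change _ ↔ ρ n j.base = 0
        split_ifs with h
        · simpa using h
        · simpa using h }
  have hg : ∀ j n a, (Φ j).g n = some a ↔
      ∃ h : ρ n j.base ≠ 0, ((L n).transition ⟨j, hmem h⟩)⁻¹ = a := by
    intro j n a
    change (if h : ρ n j.base ≠ 0 then some ((L n).transition ⟨j, hmem h⟩)⁻¹ else none) = _ ↔ _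
    split_ifs with h
    · rw [Option.some_inj]
      exact ⟨fun h' => ⟨h, h'⟩, fun ⟨_, h'⟩ => h'⟩
    · exact iff_of_false (by simp) fun ⟨h', _⟩ => h h'
  have hbase := Frame.continuous_base (l := l) hB.continuous_proj
  have hw : ∀ n, Continuous fun j : Frame l B => ρ n j.base := fun n =>
    (ρ n).continuous.comp hbase
  refine ⟨Φ, MilnorE.continuous_iff.2 ⟨hw, fun n V hV => ?_⟩, fun j a => ?_⟩
  · have hU : IsOpen {j : Frame l B | j.base ∈ (L n).base} := (L n).isOpen_base.preimage hbase
    have h1 : IsOpen ((fun j => ((L n).transition j)⁻¹) ⁻¹' V) :=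
      hV.preimage (L n).continuous_transition.inv
    have h2 := hU.isOpenMap_subtype_val _ h1
    convert (isOpen_ne_fun (hw n) continuous_const).inter h2 using 1
    ext j
    simp only [hg]
    constructor
    · rintro ⟨_, ha, h, rfl⟩
      exact ⟨h, ⟨j, hmem h⟩, ha, rfl⟩
    · rintro ⟨h, ⟨j', hj'⟩, ha, rfl⟩
      exact ⟨_, ha, h, rfl⟩
  · refine MilnorE.ext_some (fun n => rfl) fun n b => ?_
    rw [MilnorE.smul_g_eq_some_iff, hg, hg]
    refine exists_congr fun h => ?_
    rw [(L n).transition_act ⟨j, hmem h⟩ a, _root_.mul_inv_rev, inv_mul_eq_iff_eq_mul,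
      inv_inv]

/-- A map of bundles which is an isomorphism on the fibers pulls classifying maps back. -/
theorem IsClassifyingMap.comp {Y : Type w} [TopologicalSpace Y] {l : ℕ}
    {B : StarAlgBundle.{u, v} X} {C : StarAlgBundle.{w, v'} Y} {ψ : C(Y, BPU l)}
    (hψ : C.IsClassifyingMap l ψ) (f : C(X, Y)) (i : ∀ x, B.Fiber x ≃⋆ₐ[ℂ] C.Fiber (f x))
    (hi : Continuous fun p : B.Total => (⟨f p.1, i p.1 p.2⟩ : C.Total)) :
    B.IsClassifyingMap l (ψ.comp f) := by
  obtain ⟨Ψ, hc, ha, hm⟩ := hψ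
  refine ⟨fun j => Ψ ⟨f j.base, j.iso.trans (i j.base)⟩, hc.comp ?_, fun j a => ?_, fun j => ?_⟩
  · exact Frame.continuous_iff.2 fun T => hi.comp (Frame.continuous_iso_apply T)
  · exact ha ⟨f j.base, j.iso.trans (i j.base)⟩ a
  · exact hm ⟨f j.base, j.iso.trans (i j.base)⟩

/-! ### Bundles with the same classifying map -/

/-- A family of isomorphisms of fibers which is compatible with equivariant maps of the bundles of
frames to `EPU(l)` is continuous. -/
theorem continuous_of_frame_compatible {l : ℕ} {B : StarAlgBundle.{u, v} X}
    {B' : StarAlgBundle.{u, w} X} (hB : B.IsMatrixBundle l) (hB' : B'.IsMatrixBundle l)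
    {Φ : Frame l B → EPU l} {Φ' : Frame l B' → EPU l} (hΦ : Continuous Φ) (hΦ' : Continuous Φ')
    (hact' : ∀ j (a : PU l), Φ' (j.act a) = a⁻¹ • Φ' j) (β : ∀ x, B.Fiber x ≃⋆ₐ[ℂ] B'.Fiber x)
    (hβ : ∀ x (i : Mat l ≃⋆ₐ[ℂ] B.Fiber x), Φ ⟨x, i⟩ = Φ' ⟨x, i.trans (β x)⟩) :
    Continuous fun p : B.Total => (⟨p.1, β p.1 p.2⟩ : B'.Total) := by
  rw [continuous_iff_continuousAt]
  rintro ⟨x, b⟩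
  obtain ⟨L, hx⟩ := hB.exists_localFrame x
  obtain ⟨L', hx'⟩ := hB'.exists_localFrame x
  let W : Set X := L.base ∩ L'.base
  have hW : IsOpen (B.proj ⁻¹' W) :=
    (L.isOpen_base.inter L'.isOpen_base).preimage hB.continuous_proj
  -- the isomorphism in the coordinates of the two local frames
  let c : W → PU l := fun y =>
    (PU.conjEquiv l).symm (((L.coord ⟨y, y.2.1⟩).symm.trans (β y)).trans (L'.coord ⟨y, y.2.2⟩))
  have hc : ∀ y, PU.conj l (c y) =
      ((L.coord ⟨y, y.2.1⟩).symm.trans (β y)).trans (L'.coord ⟨y, y.2.2⟩) := fun y =>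
    PU.conj_conjEquiv_symm _
  have hcc : Continuous c := by
    have h1 : Continuous fun y : W => Φ (L.frame ⟨y, y.2.1⟩) :=
      hΦ.comp (L.continuous_frame.comp (by fun_prop))
    have h2 : Continuous fun y : W => Φ' (L'.frame ⟨y, y.2.2⟩) :=
      hΦ'.comp (L'.continuous_frame.comp (by fun_prop))
    have h3 : ∀ y : W, Φ (L.frame ⟨y, y.2.1⟩) = (c y)⁻¹ • Φ' (L'.frame ⟨y, y.2.2⟩) := by
      intro y
      rw [← hact']
      simp only [LocalFrame.frame, Frame.act, hc]
      rw [hβ]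
      congr 2
      ext1 T
      exact ((L'.coord ⟨y, y.2.2⟩).symm_apply_apply _).symm
    exact (MilnorE.continuous_of_smul_eq h1 h2 h3).inv.congr fun y => inv_inv (c y)
  have hon : ContinuousOn (fun p : B.Total => (⟨p.1, β p.1 p.2⟩ : B'.Total)) (B.proj ⁻¹' W) := by
    rw [continuousOn_iff_continuous_domRestrict]
    have hp : Continuous fun p : (B.proj ⁻¹' W : Set B.Total) => (⟨p.1.1, p.2⟩ : W) :=
      (hB.continuous_proj.comp continuous_subtype_val).subtype_mk _
    have h4 : Continuous fun p : (B.proj ⁻¹' W : Set B.Total) =>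
        L.coord ⟨p.1.1, p.2.1⟩ p.1.2 :=
      L.continuous_coord.comp (f := fun p : (B.proj ⁻¹' W : Set B.Total) =>
        (⟨p.1, p.2.1⟩ : {p : B.Total // p.1 ∈ L.base})) (by fun_prop)
    have h5 := PU.continuous_conj.comp ((hcc.comp hp).prodMk h4)
    have h6 := L'.continuous_symm.comp (Continuous.prodMk
      (f := fun p : (B.proj ⁻¹' W : Set B.Total) => (⟨p.1.1, p.2.2⟩ : L'.base))
      ((hB.continuous_proj.comp continuous_subtype_val).subtype_mk _) h5)
    refine h6.congr fun p => ?_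
    simp [hc, Set.domRestrict]
  exact hon.continuousAt (hW.mem_nhds ⟨hx, hx'⟩)

/-- Bundles of matrix algebras with a common classifying map are isomorphic. -/
theorem IsClassifyingMap.nonempty_iso {l : ℕ} {B : StarAlgBundle.{u, v} X}
    {B' : StarAlgBundle.{u, w} X} (hB : B.IsMatrixBundle l) (hB' : B'.IsMatrixBundle l)
    {φ : C(X, BPU l)} (hφ : B.IsClassifyingMap l φ) (hφ' : B'.IsClassifyingMap l φ) :
    Nonempty (B.Iso B') := by
  obtain ⟨Φ, hc, ha, hm⟩ := hφ
  obtain ⟨Φ', hc', ha', hm'⟩ := hφ'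
  have key : ∀ x, ∃ β : B.Fiber x ≃⋆ₐ[ℂ] B'.Fiber x, ∀ i : Mat l ≃⋆ₐ[ℂ] B.Fiber x,
      Φ ⟨x, i⟩ = Φ' ⟨x, i.trans β⟩ := by
    intro x
    obtain ⟨i⟩ := hB.nonempty_frame x
    obtain ⟨i'⟩ := hB'.nonempty_frame x
    obtain ⟨a, haa : a • Φ' ⟨x, i'⟩ = Φ ⟨x, i⟩⟩ :=
      Quotient.exact ((hm ⟨x, i⟩).symm.trans (hm' ⟨x, i'⟩))
    refine ⟨i.symm.trans ((PU.conj l a⁻¹).trans i'), fun j => ?_⟩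
    obtain ⟨b, hb⟩ := Frame.exists_act_eq i j
    have hb' : (⟨x, j.trans (i.symm.trans ((PU.conj l a⁻¹).trans i'))⟩ : Frame l B') =
        (Frame.act ⟨x, i'⟩ a⁻¹).act b := by
      have h1 : j = (PU.conj l b).trans i := by
        simp only [Frame.act, Frame.mk.injEq, heq_eq_eq, true_and] at hb
        exact hb
      simp only [Frame.act, h1]
      congr 1
      ext1 T
      exact congrArg (fun S => i' (PU.conj l a⁻¹ S)) (i.symm_apply_apply (PU.conj l b T))
    rw [hb, hb', ha, ha', ha', inv_inv, haa]
  choose β hβ using key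
  refine ⟨⟨β, continuous_of_frame_compatible hB hB' hc hc' ha' β hβ,
    continuous_of_frame_compatible hB' hB hc' hc ha (fun x => (β x).symm) fun x i => ?_⟩⟩
  rw [hβ]
  congr 2
  ext1 T
  simp

end StarAlgBundle

/-! ### The topology of `Fr_{k,l}` -/

/-- `Fr_{k,l}` is a subspace of a finite-dimensional vector space, by evaluation at the matrix
units. -/
theorem Fr.isEmbedding_single (k l : ℕ) : Topology.IsEmbedding
    fun (h : Fr k l) (p : Fin k × Fin k) => h (Matrix.single p.1 p.2 1) := by
  refine ⟨?_, fun h h' hh => ?_⟩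
  · let r : (Fin k × Fin k → Mat (k * l)) → Mat k → Mat (k * l) :=
      fun F T => ∑ i, ∑ j, T i j • F (i, j)
    have hr : Continuous r := by fun_prop
    refine .of_comp (continuous_pi fun p => Fr.continuous_apply _) hr ⟨?_⟩
    have hcomp : (r ∘ fun (h : Fr k l) (p : Fin k × Fin k) => h (Matrix.single p.1 p.2 1)) =
        fun h : Fr k l => (h : Mat k → Mat (k * l)) :=
      funext fun h => funext fun T => (starHom_eq_sum h T).symm
    rw [hcomp]
    rfl
  · ext1 T
    rw [starHom_eq_sum h, starHom_eq_sum h']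
    exact Finset.sum_congr rfl fun i _ => Finset.sum_congr rfl fun j _ =>
      congrArg (T i j • ·) (congrFun hh (i, j))

theorem Fr.metrizableSpace (k l : ℕ) : TopologicalSpace.MetrizableSpace (Fr k l) := by
  let : MetricSpace (Mat (k * l)) := inferInstanceAs (MetricSpace (Fin (k * l) → Fin (k * l) → ℂ))
  exact (Fr.isEmbedding_single k l).metrizableSpace

theorem Fr.secondCountableTopology (k l : ℕ) : SecondCountableTopology (Fr k l) := by
  have : SecondCountableTopology (Mat (k * l)) :=
    inferInstanceAs (SecondCountableTopology (Fin (k * l) → Fin (k * l) → ℂ))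
  exact (Fr.isEmbedding_single k l).secondCountableTopology

theorem exists_isClassifyingMap_centralizerBundle (k l : ℕ) (hk : 0 < k) :
    ∃ ψ : C(Fr k l, BPU l), (centralizerBundle k l).IsClassifyingMap l ψ := by
  have := Fr.secondCountableTopology k l
  have := Fr.metrizableSpace k l
  let := TopologicalSpace.metrizableSpaceMetric (Fr k l)
  exact (isMatrixBundle_centralizerBundle k l hk).exists_isClassifyingMap

/-! ### Homomorphisms out of `M_k(ℂ) ⊗ A` -/

section TensorMatrix

variable {k N : ℕ} {A : Type v} [Ring A] [Algebra ℂ A]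

/-- The coefficient map `c ⊗ id : M_k(ℂ) ⊗ A → A`. -/
def tensorSlice (A : Type v) [Ring A] [Algebra ℂ A] (c : Module.Dual ℂ (Mat k)) :
    Mat k ⊗[ℂ] A →ₗ[ℂ] A :=
  (TensorProduct.lid ℂ A).toLinearMap ∘ₗ c.rTensor A

@[simp] theorem tensorSlice_tmul (c : Module.Dual ℂ (Mat k)) (T : Mat k) (b : A) :
    tensorSlice A c (T ⊗ₜ[ℂ] b) = c T • b := rfl

/-- The functional `T ↦ T i j` on matrices. -/
def entryDual (i j : Fin k) : Module.Dual ℂ (Mat k) := Matrix.entryLinearMap ℂ ℂ i j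

@[simp] theorem entryDual_apply (i j : Fin k) (T : Mat k) : entryDual i j T = T i j := rfl

theorem tmul_eq_mul (T : Mat k) (b : A) :
    T ⊗ₜ[ℂ] b = (T ⊗ₜ[ℂ] (1 : A)) * ((1 : Mat k) ⊗ₜ[ℂ] b) := by
  rw [Algebra.TensorProduct.tmul_mul_tmul, mul_one, one_mul]

variable {h : Mat k →⋆ₐ[ℂ] Mat N}

section Extend

variable [StarRing A] (α : A ≃⋆ₐ[ℂ] StarSubalgebra.centralizer ℂ (Set.range h))

theorem commute_coe_centralizer (b : A) (T : Mat k) :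
    h T * (α b : Mat N) = (α b : Mat N) * h T :=
  (mem_centralizer_range_iff h).1 (α b).2 T

/-- The homomorphism `T ⊗ b ↦ h(T) α(b)`. -/
def tensorCentralizerHom : Mat k ⊗[ℂ] A →ₐ[ℂ] Mat N :=
  Algebra.TensorProduct.lift h.toAlgHom
    ((StarSubalgebra.subtype (StarSubalgebra.centralizer ℂ (Set.range h))).toAlgHom.comp
      (AlgHomClass.toAlgHom α))
    fun T b => commute_coe_centralizer α b T

theorem tensorCentralizerHom_tmul (T : Mat k) (b : A) :
    tensorCentralizerHom α (T ⊗ₜ[ℂ] b) = h T * (α b : Mat N) :=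
  Algebra.TensorProduct.lift_tmul _ _ _ _ _

theorem tensorCentralizerHom_apply (s : Mat k ⊗[ℂ] A) : tensorCentralizerHom α s =
    ∑ i, ∑ j, h (single i j 1) * (α (tensorSlice A (entryDual i j) s) : Mat N) := by
  induction s with
  | zero => simp
  | add s t hs ht =>
    rw [map_add, hs, ht]
    simp [mul_add, Finset.sum_add_distrib]
  | tmul T b =>
    rw [tensorCentralizerHom_tmul, starHom_eq_sum h T]
    simp [Finset.sum_mul]

/-- The expansion of a matrix in the matrix units of `h`, with coefficients in `A`. -/
def tensorCentralizerInv (z : Mat N) : Mat k ⊗[ℂ] A :=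
  ∑ i, ∑ j, single i j 1 ⊗ₜ[ℂ] α.symm ⟨unitCoeff h i j z, unitCoeff_mem_centralizer h i j z⟩

theorem tensorCentralizerHom_inv (z : Mat N) :
    tensorCentralizerHom α (tensorCentralizerInv α z) = z := by
  simp only [tensorCentralizerInv, map_sum, tensorCentralizerHom_tmul,
    StarAlgEquiv.apply_symm_apply]
  exact sum_mul_unitCoeff h z

theorem tensorSlice_inv (c : Module.Dual ℂ (Mat k)) (z : Mat N) :
    tensorSlice A c (tensorCentralizerInv α z) = α.symm (∑ i, ∑ j,
      c (single i j 1) • ⟨unitCoeff h i j z, unitCoeff_mem_centralizer h i j z⟩) := by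
  simp only [tensorCentralizerInv, map_sum, tensorSlice_tmul, map_smul]

theorem tensorCentralizerInv_hom (s : Mat k ⊗[ℂ] A) :
    tensorCentralizerInv α (tensorCentralizerHom α s) = s := by
  have hadd : ∀ z z', tensorCentralizerInv α (z + z') =
      tensorCentralizerInv α z + tensorCentralizerInv α z' := by
    intro z z'
    simp only [tensorCentralizerInv, ← Finset.sum_add_distrib, ← TensorProduct.tmul_add]
    refine Finset.sum_congr rfl fun i _ => Finset.sum_congr rfl fun j _ => ?_
    rw [← map_add]
    congr 2
    ext1
    exact map_add _ _ _
  induction s with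
  | zero =>
    have := hadd 0 0
    rw [add_zero] at this
    rw [map_zero]
    exact left_eq_add.1 this
  | add s t hs ht => rw [map_add, hadd, hs, ht]
  | tmul T b =>
    have h1 : ∀ i j, α.symm ⟨unitCoeff h i j (h T * (α b : Mat N)),
        unitCoeff_mem_centralizer h i j _⟩ = T i j • b := by
      intro i j
      rw [← α.symm_apply_apply (T i j • b), map_smul]
      congr 1
      ext1
      exact unitCoeff_mul h T i j (commute_coe_centralizer α b)
    rw [tensorCentralizerHom_tmul]
    simp only [tensorCentralizerInv, h1, ← TensorProduct.smul_tmul, ← TensorProduct.sum_tmul]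
    congr 1
    conv_rhs => rw [matrix_eq_sum_single T]
    simp

variable [StarModule ℂ A]

/-- An isomorphism from `A` to the centralizer of `h(M_k(ℂ))` in `M_N(ℂ)` extends to an isomorphism
`M_k(ℂ) ⊗ A ≅ M_N(ℂ)` which is `h` on the first factor. -/
def tensorCentralizerEquiv : Mat k ⊗[ℂ] A ≃⋆ₐ[ℂ] Mat N where
  toFun := tensorCentralizerHom α
  invFun := tensorCentralizerInv α
  left_inv := tensorCentralizerInv_hom α
  right_inv := tensorCentralizerHom_inv α
  map_mul' := map_mul _
  map_add' := map_add _
  map_smul' := map_smul _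
  map_star' s := by
    induction s with
    | zero => simp
    | add s t hs ht => rw [star_add, map_add, hs, ht, map_add, star_add]
    | tmul T b =>
      rw [TensorProduct.star_tmul, tensorCentralizerHom_tmul, tensorCentralizerHom_tmul, map_star,
        map_star, StarMemClass.coe_star, star_mul, ← map_star h, ← StarMemClass.coe_star,
        ← map_star α]
      exact commute_coe_centralizer α _ _

end Extend

variable [StarRing A] [StarModule ℂ A]

/-- The restriction of a homomorphism to the tensor factor `M_k(ℂ)`. -/
def restrictMatrix (θ : Mat k ⊗[ℂ] A →⋆ₐ[ℂ] Mat N) : Mat k →⋆ₐ[ℂ] Mat N where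
  toAlgHom := θ.toAlgHom.comp Algebra.TensorProduct.includeLeft
  map_star' T := by
    change θ (star T ⊗ₜ[ℂ] 1) = star (θ (T ⊗ₜ[ℂ] 1))
    rw [← map_star, TensorProduct.star_tmul, star_one]

theorem commute_map_one_tmul {θ : Mat k ⊗[ℂ] A →⋆ₐ[ℂ] Mat N} (hθ : ∀ T, θ (T ⊗ₜ[ℂ] 1) = h T)
    (b : A) (T : Mat k) : h T * θ (1 ⊗ₜ[ℂ] b) = θ (1 ⊗ₜ[ℂ] b) * h T := by
  rw [← hθ, ← map_mul, ← map_mul, Algebra.TensorProduct.tmul_mul_tmul,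
    Algebra.TensorProduct.tmul_mul_tmul, one_mul, mul_one, one_mul, mul_one]

theorem unitCoeff_map {θ : Mat k ⊗[ℂ] A →⋆ₐ[ℂ] Mat N} (hθ : ∀ T, θ (T ⊗ₜ[ℂ] 1) = h T)
    (i j : Fin k) (s : Mat k ⊗[ℂ] A) :
    unitCoeff h i j (θ s) = θ (1 ⊗ₜ[ℂ] tensorSlice A (entryDual i j) s) := by
  induction s with
  | zero => simp
  | add s t hs ht => rw [map_add, map_add, hs, ht, map_add, TensorProduct.tmul_add, map_add]
  | tmul T b =>
    rw [tmul_eq_mul, map_mul, hθ, unitCoeff_mul h T i j (commute_map_one_tmul hθ b), ← tmul_eq_mul,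
      tensorSlice_tmul, entryDual_apply, TensorProduct.tmul_smul, map_smul]

/-- An isomorphism `M_k(ℂ) ⊗ A ≅ M_N(ℂ)` restricts to an isomorphism from `A` to the centralizer
of the image of `M_k(ℂ)`. -/
def restrictCentralizer (θ : Mat k ⊗[ℂ] A ≃⋆ₐ[ℂ] Mat N) (hθ : ∀ T, θ (T ⊗ₜ[ℂ] 1) = h T)
    (i : Fin k) : A ≃⋆ₐ[ℂ] StarSubalgebra.centralizer ℂ (Set.range h) where
  toFun b := ⟨θ (1 ⊗ₜ[ℂ] b), (mem_centralizer_range_iff h).2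
    (commute_map_one_tmul (θ := (θ : Mat k ⊗[ℂ] A →⋆ₐ[ℂ] Mat N)) hθ b)⟩
  invFun z := tensorSlice A (entryDual i i) (θ.symm z)
  left_inv b := by simp
  right_inv := by
    rintro ⟨z, hz⟩
    ext1
    change θ (1 ⊗ₜ[ℂ] tensorSlice A (entryDual i i) (θ.symm z)) = z
    refine (unitCoeff_map (θ := (θ : Mat k ⊗[ℂ] A →⋆ₐ[ℂ] Mat N)) hθ i i (θ.symm z)).symm.trans ?_
    change unitCoeff h i i (θ (θ.symm z)) = z
    have := unitCoeff_mul h 1 i i ((mem_centralizer_range_iff h).1 hz)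
    rw [StarAlgEquiv.apply_symm_apply]
    simpa using this
  map_mul' a b := by
    ext1
    change θ (1 ⊗ₜ[ℂ] (a * b)) = θ (1 ⊗ₜ[ℂ] a) * θ (1 ⊗ₜ[ℂ] b)
    rw [← map_mul, Algebra.TensorProduct.tmul_mul_tmul, one_mul]
  map_add' a b := by
    ext1
    change θ (1 ⊗ₜ[ℂ] (a + b)) = θ (1 ⊗ₜ[ℂ] a) + θ (1 ⊗ₜ[ℂ] b)
    rw [← map_add, TensorProduct.tmul_add]
  map_star' a := by
    ext1
    change θ (1 ⊗ₜ[ℂ] star a) = star (θ (1 ⊗ₜ[ℂ] a))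
    rw [← map_star, TensorProduct.star_tmul, star_one]
  map_smul' c a := by
    ext1
    change θ (1 ⊗ₜ[ℂ] (c • a)) = c • θ (1 ⊗ₜ[ℂ] a)
    rw [TensorProduct.tmul_smul, map_smul]

end TensorMatrix

/-! ### Trivializations of `[M_k] ⊗ B` -/

namespace StarAlgBundle

variable {X : Type u}

namespace Iso

/-- The inverse of an isomorphism of bundles. -/
def symm {B : StarAlgBundle.{u, v} X} {C : StarAlgBundle.{u, w} X} (α : B.Iso C) : C.Iso B where
  fiber x := (α.fiber x).symm
  continuous_toFun := α.continuous_invFun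
  continuous_invFun := α.continuous_toFun

/-- The composite of isomorphisms of bundles. -/
def trans {B : StarAlgBundle.{u, v} X} {C : StarAlgBundle.{u, w} X} {D : StarAlgBundle.{u, v'} X}
    (α : B.Iso C) (β : C.Iso D) : B.Iso D where
  fiber x := (α.fiber x).trans (β.fiber x)
  continuous_toFun := β.continuous_toFun.comp α.continuous_toFun
  continuous_invFun := α.continuous_invFun.comp β.continuous_invFun

end Iso

theorem continuous_tensorMatrix_iff {k : ℕ} {B : StarAlgBundle.{u, v} X} {Z : Type*}
    [TopologicalSpace Z] {g : Z → (B.tensorMatrix k).Total} :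
    Continuous g ↔ ∀ c : Module.Dual ℂ (Mat k),
      Continuous fun z => (⟨(g z).1, tensorSlice (B.Fiber (g z).1) c (g z).2⟩ : B.Total) :=
  continuous_iInf_rng.trans (forall_congr' fun _ => continuous_induced_rng)

theorem continuous_tensorSlice {k : ℕ} (B : StarAlgBundle.{u, v} X) (c : Module.Dual ℂ (Mat k)) :
    Continuous fun p : (B.tensorMatrix k).Total =>
      (⟨p.1, tensorSlice (B.Fiber p.1) c p.2⟩ : B.Total) :=
  continuous_tensorMatrix_iff.1 continuous_id c

variable [TopologicalSpace X]

theorem continuous_trivial_iff {n : ℕ} {Z : Type*} [TopologicalSpace Z]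
    {g : Z → (trivial X n).Total} :
    Continuous g ↔ Continuous (fun z => (g z).1) ∧ Continuous (fun z => ((g z).2 : Mat n)) :=
  continuous_induced_rng.trans continuous_prodMk

theorem IsMatrixBundle.continuous_smul {n : ℕ} {B : StarAlgBundle.{u, v} X}
    (hB : B.IsMatrixBundle n) (c : ℂ) :
    Continuous fun p : B.Total => (⟨p.1, c • p.2⟩ : B.Total) := by
  rw [continuous_iff_continuousAt]
  rintro ⟨x, b⟩
  obtain ⟨L, hx⟩ := hB.exists_localFrame x
  have h1 : ContinuousOn (fun p : B.Total => (⟨p.1, c • p.2⟩ : B.Total)) (B.proj ⁻¹' L.base) := by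
    rw [continuousOn_iff_continuous_domRestrict]
    have h2 : Continuous fun p : (B.proj ⁻¹' L.base : Set B.Total) => (⟨p.1.1, p.2⟩ : L.base) :=
      (hB.continuous_proj.comp continuous_subtype_val).subtype_mk _
    have h3 : Continuous fun p : (B.proj ⁻¹' L.base : Set B.Total) =>
        c • L.coord ⟨p.1.1, p.2⟩ p.1.2 := L.continuous_coord.const_smul c
    refine (L.continuous_symm.comp (h2.prodMk h3)).congr fun p => ?_
    simp [Set.domRestrict]
  exact h1.continuousAt ((L.isOpen_base.preimage hB.continuous_proj).mem_nhds hx)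

variable {k l : ℕ} {B : StarAlgBundle.{u, v} X}

/-- A trivialization of `[M_k] ⊗ B` on the fiber over `x`. -/
def StableTriv.equiv (θ : StableTriv k l B) (x : X) : Mat k ⊗[ℂ] B.Fiber x ≃⋆ₐ[ℂ] Mat (k * l) :=
  Iso.fiber θ x

theorem StableTriv.app_eq (θ : StableTriv k l B) (x : X) (s : Mat k ⊗[ℂ] B.Fiber x) :
    θ.app x s = θ.equiv x s := rfl

theorem StableTriv.continuous_app (θ : StableTriv k l B) :
    Continuous fun p : (B.tensorMatrix k).Total => θ.app p.1 p.2 :=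
  (continuous_trivial_iff.1 (Iso.continuous_toFun θ)).2

theorem StableTriv.app_tmul (θ : StableTriv k l B) (x : X) (T : Mat k) (b : B.Fiber x) :
    θ.app x (T ⊗ₜ[ℂ] b) = θ.app x (T ⊗ₜ[ℂ] (1 : B.Fiber x)) * θ.app x ((1 : Mat k) ⊗ₜ[ℂ] b) := by
  rw [tmul_eq_mul]
  exact map_mul (θ.equiv x) _ _

theorem StableTriv.ext_app {θ θ' : StableTriv k l B} (h : ∀ x s, θ.app x s = θ'.app x s) : θ = θ' :=
  Iso.ext (funext fun x => StarAlgEquiv.ext (h x))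

theorem StableTriv.ext_tmul {θ θ' : StableTriv k l B}
    (h : ∀ x T b, θ.app x (T ⊗ₜ[ℂ] b) = θ'.app x (T ⊗ₜ[ℂ] b)) : θ = θ' := by
  refine StableTriv.ext_app fun x s => ?_
  simp only [StableTriv.app_eq] at h ⊢
  induction s with
  | zero => rw [map_zero, map_zero]
  | add s t hs ht => rw [map_add, map_add, hs, ht]
  | tmul T b => exact h x T b

/-- The elements `T ⊗ b` depend continuously on `b`. -/
theorem IsMatrixBundle.continuous_tmul (hB : B.IsMatrixBundle l) (T : Mat k) :
    Continuous fun p : B.Total => (⟨p.1, T ⊗ₜ[ℂ] p.2⟩ : (B.tensorMatrix k).Total) :=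
  continuous_tensorMatrix_iff.2 fun c => hB.continuous_smul (c T)

/-- A trivialization of `[M_k] ⊗ B` gives a map to `Fr_{k,l}`. -/
theorem StableTriv.exists_induces (hB : B.IsMatrixBundle l) (θ : StableTriv k l B) :
    ∃ f : C(X, Fr k l), θ.Induces f := by
  let f : X → Fr k l := fun x =>
    restrictMatrix (θ.equiv x : Mat k ⊗[ℂ] B.Fiber x →⋆ₐ[ℂ] Mat (k * l))
  have hf : Continuous f := by
    refine continuous_induced_rng.2 (continuous_pi fun T => ?_)
    exact θ.continuous_app.comp ((hB.continuous_tmul T).comp hB.continuous_unit)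
  exact ⟨⟨f, hf⟩, fun x T => rfl⟩

/-- A trivialization of `[M_k] ⊗ B` which induces `f` identifies `B` with the centralizers. -/
theorem StableTriv.Induces.exists_corresponds (hk : 0 < k) (hB : B.IsMatrixBundle l)
    {θ : StableTriv k l B} {f : C(X, Fr k l)} (hf : θ.Induces f) :
    ∃ α : B.Iso (pullback f (centralizerBundle k l)), θ.Corresponds f α := by
  let i : Fin k := ⟨0, hk⟩
  refine ⟨⟨fun x => restrictCentralizer (θ.equiv x) (hf x) i, ?_, ?_⟩, hf, fun x b => rfl⟩
  · refine pullback_total_continuous_iff.2 ⟨hB.continuous_proj, ?_⟩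
    refine centralizerBundle_total_continuous_iff.2 ⟨f.continuous.comp hB.continuous_proj, ?_⟩
    exact θ.continuous_app.comp (hB.continuous_tmul 1)
  · have h1 : Continuous fun p : (pullback f (centralizerBundle k l)).Total =>
        (⟨p.1, centralizerVal (h := f p.1) p.2⟩ : (trivial X (k * l)).Total) :=
      continuous_trivial_iff.2 ⟨continuous_pullback_proj f _,
        (centralizerBundle_total_continuous_iff.1 (continuous_pullback_lift f _)).2⟩
    exact (continuous_tensorSlice B (entryDual i i)).comp ((Iso.continuous_invFun θ).comp h1)

/-- An isomorphism of `B` with the bundle of centralizers of `f` extends to a trivialization of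
`[M_k] ⊗ B`. -/
theorem exists_corresponds (f : C(X, Fr k l))
    (α : B.Iso (pullback f (centralizerBundle k l))) :
    ∃ θ : StableTriv k l B, θ.Corresponds f α := by
  let a : ∀ x, B.Fiber x ≃⋆ₐ[ℂ] StarSubalgebra.centralizer ℂ (Set.range (f x)) := α.fiber
  have hproj : Continuous fun p : (B.tensorMatrix k).Total => p.1 :=
    (continuous_pullback_proj f _).comp (α.continuous_toFun.comp (continuous_tensorSlice B 0))
  have happ : ∀ x T b, tensorCentralizerEquiv (a x) (T ⊗ₜ[ℂ] b) = f x T * (a x b : Mat (k * l)) :=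
    fun x T b => tensorCentralizerHom_tmul (a x) T b
  refine ⟨⟨fun x => tensorCentralizerEquiv (a x), ?_, ?_⟩, ?_, ?_⟩
  · refine continuous_trivial_iff.2 ⟨hproj, ?_⟩
    have h1 : Continuous fun p : (B.tensorMatrix k).Total =>
        ∑ i, ∑ j, f p.1 (single i j 1) *
          (a p.1 (tensorSlice (B.Fiber p.1) (entryDual i j) p.2) : Mat (k * l)) := by
      refine continuous_finsetSum _ fun i _ => continuous_finsetSum _ fun j _ => ?_
      refine ((Fr.continuous_apply _).comp (f.continuous.comp hproj)).mul ?_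
      exact (centralizerBundle_total_continuous_iff.1 ((continuous_pullback_lift f _).comp
        (α.continuous_toFun.comp (continuous_tensorSlice B (entryDual i j))))).2
    exact h1.congr fun p => (tensorCentralizerHom_apply (a p.1) p.2).symm
  · refine continuous_tensorMatrix_iff.2 fun c => ?_
    obtain ⟨hp, hz⟩ := continuous_trivial_iff.1 (continuous_id (X := (trivial X (k * l)).Total))
    let z : (trivial X (k * l)).Total → Mat (k * l) := fun p => p.2
    let s : (trivial X (k * l)).Total → (pullback f (centralizerBundle k l)).Total := fun p =>
      ⟨p.1, (∑ i, ∑ j, c (single i j 1) • ⟨unitCoeff (f p.1) i j p.2,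
        unitCoeff_mem_centralizer (f p.1) i j p.2⟩ :
          StarSubalgebra.centralizer ℂ (Set.range (f p.1)))⟩
    have hs : Continuous s := by
      refine pullback_total_continuous_iff.2 ⟨hp, centralizerBundle_total_continuous_iff.2
        ⟨f.continuous.comp hp, ?_⟩⟩
      have h2 : Continuous fun p : (trivial X (k * l)).Total =>
          ∑ i, ∑ j, c (single i j 1) • unitCoeff (f p.1) i j (z p) := by
        refine continuous_finsetSum _ fun i _ => continuous_finsetSum _ fun j _ => ?_
        have h3 : ∀ T, Continuous fun p : (trivial X (k * l)).Total => f p.1 T := fun T =>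
          (Fr.continuous_apply T).comp (f.continuous.comp hp)
        have h4 : Continuous fun p => unitCoeff (f p.1) i j (z p) := by
          simp only [unitCoeff_apply]
          exact continuous_finsetSum _ fun m _ => ((h3 _).mul hz).mul (h3 _)
        exact h4.const_smul (c (single i j 1))
      refine h2.congr fun p => ?_
      simp only [s, centralizerVal]
      change _ = (StarSubalgebra.subtype _) (∑ i, ∑ j, _)
      simp only [map_sum, map_smul]
      rfl
    refine (α.continuous_invFun.comp hs).congr fun p => ?_
    exact congrArg (Bundle.TotalSpace.mk p.1) (tensorSlice_inv (a p.1) c p.2).symm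
  · intro x T
    refine (happ x T 1).trans ?_
    rw [map_one]
    exact mul_one _
  · intro x b
    refine (happ x 1 b).trans ?_
    rw [map_one, one_mul]
    rfl

theorem StableTriv.Corresponds.app_tmul {θ : StableTriv k l B} {f : C(X, Fr k l)}
    {α : B.Iso (pullback f (centralizerBundle k l))} (h : θ.Corresponds f α) (x : X) (T : Mat k)
    (b : B.Fiber x) : θ.app x (T ⊗ₜ[ℂ] b) = f x T * centralizerApp α x b := by
  rw [StableTriv.app_tmul, h.1, h.2]

theorem centralizerApp_injective {f : C(X, Fr k l)}
    {α α' : B.Iso (pullback f (centralizerBundle k l))}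
    (h : ∀ x b, centralizerApp α x b = centralizerApp α' x b) : α = α' :=
  Iso.ext (funext fun x => StarAlgEquiv.ext fun b => Subtype.ext (h x b))

theorem StableTriv.Corresponds.unique {θ : StableTriv k l B} {f f' : C(X, Fr k l)}
    {α : B.Iso (pullback f (centralizerBundle k l))}
    {α' : B.Iso (pullback f' (centralizerBundle k l))} (h : θ.Corresponds f α)
    (h' : θ.Corresponds f' α') :
    (⟨f, α⟩ : Σ f : C(X, Fr k l), B.Iso (pullback f (centralizerBundle k l))) = ⟨f', α'⟩ := by
  obtain rfl : f = f' := by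
    ext1 x
    ext1 T
    rw [← h.1, ← h'.1]
  rw [centralizerApp_injective fun x b => (h.2 x b).symm.trans (h'.2 x b)]

end StarAlgBundle

open StarAlgBundle


theorem proposition2 (k l : ℕ) (hk : 0 < k) (hl : 0 < l) :
    -- the centralizer bundle over `Fr_{k,l}` is an `M_l(ℂ)`-bundle, and has a classifying map
    (centralizerBundle k l).IsMatrixBundle l ∧
    (∃ ψ : C(Fr k l, BPU l), (centralizerBundle k l).IsClassifyingMap l ψ) ∧
    (∀ (X : Type u) [TopologicalSpace X] (B : StarAlgBundle.{u, v} X), B.IsMatrixBundle l →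
      -- if `[M_k] ⊗ B` is trivial, the classifying maps of `B` lift to `Fr_{k,l}`
      (Nonempty (B.StableTriv k l) →
        (∃ φ : C(X, BPU l), B.IsClassifyingMap l φ) ∧
        ∃ f : C(X, Fr k l),
          Nonempty (B.Iso (StarAlgBundle.pullback f (centralizerBundle k l))) ∧
          ∀ ψ : C(Fr k l, BPU l), (centralizerBundle k l).IsClassifyingMap l ψ →
            B.IsClassifyingMap l (ψ.comp f) ∧
            ∀ φ : C(X, BPU l), B.IsClassifyingMap l φ → (ψ.comp f).Homotopic φ) ∧
      -- trivializations of `[M_k] ⊗ B` correspond bijectively to the lifts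
      (∀ θ : B.StableTriv k l,
        ∃! q : (Σ f : C(X, Fr k l), B.Iso (StarAlgBundle.pullback f (centralizerBundle k l))),
          θ.Corresponds q.1 q.2) ∧
      (∀ (f : C(X, Fr k l)) (α : B.Iso (StarAlgBundle.pullback f (centralizerBundle k l))),
        ∃! θ : B.StableTriv k l, θ.Corresponds f α) ∧
      -- `f` lifts a classifying map of `B` iff it comes from a trivialization
      (∀ ψ : C(Fr k l, BPU l), (centralizerBundle k l).IsClassifyingMap l ψ →
        ∀ f : C(X, Fr k l),
          B.IsClassifyingMap l (ψ.comp f) ↔ ∃ θ : B.StableTriv k l, θ.Induces f)) ∧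
    -- maps `X → Fr_{k,l}` are the same as isomorphism classes of pairs `(B, θ)`
    (∀ (X : Type u) [TopologicalSpace X] (f : C(X, Fr k l)),
      (StarAlgBundle.pullback f (centralizerBundle k l)).IsMatrixBundle l ∧
      (∃ θ : (StarAlgBundle.pullback f (centralizerBundle k l)).StableTriv k l, θ.Induces f) ∧
      ∀ (B : StarAlgBundle.{u, v} X) (B' : StarAlgBundle.{u, w} X),
        B.IsMatrixBundle l → B'.IsMatrixBundle l →
        ∀ (θ : B.StableTriv k l) (θ' : B'.StableTriv k l), θ.Induces f →
          (θ'.Induces f ↔ ∃ β : B.Iso B', ∀ (x : X) (T : Mat k) (b : B.Fiber x),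
            θ'.app x (T ⊗ₜ[ℂ] β.fiber x b) = θ.app x (T ⊗ₜ[ℂ] b))) := by
  have hC := isMatrixBundle_centralizerBundle k l hk
  -- pulling back along `f` turns a classifying map of the centralizers into one of `B`
  have hclass : ∀ (X : Type u) [TopologicalSpace X] (B : StarAlgBundle.{u, v} X)
      (f : C(X, Fr k l)), B.Iso (pullback f (centralizerBundle k l)) →
      ∀ ψ : C(Fr k l, BPU l), (centralizerBundle k l).IsClassifyingMap l ψ →
        B.IsClassifyingMap l (ψ.comp f) := fun X _ B f α ψ hψ =>
    IsClassifyingMap.comp hψ f α.fiber ((continuous_pullback_lift f _).comp α.continuous_toFun)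
  refine ⟨hC, exists_isClassifyingMap_centralizerBundle k l hk, fun X _ B hB => ⟨?_, ?_, ?_, ?_⟩,
    fun X _ f => ⟨hC.pullback f, ?_, fun B B' hB hB' θ θ' hθ => ⟨fun hθ' => ?_, ?_⟩⟩⟩
  · rintro ⟨θ⟩
    obtain ⟨f, hf⟩ := θ.exists_induces hB
    obtain ⟨α, -⟩ := hf.exists_corresponds hk hB
    obtain ⟨ψ, hψ⟩ := exists_isClassifyingMap_centralizerBundle k l hk
    exact ⟨⟨ψ.comp f, hclass X B f α ψ hψ⟩, f, ⟨α⟩, fun ψ hψ => ⟨hclass X B f α ψ hψ,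
      fun φ hφ => (hclass X B f α ψ hψ).homotopic hB hφ⟩⟩
  · intro θ
    obtain ⟨f, hf⟩ := θ.exists_induces hB
    obtain ⟨α, hα⟩ := hf.exists_corresponds hk hB
    exact ⟨⟨f, α⟩, hα, fun q hq => hq.unique hα⟩
  · intro f α
    obtain ⟨θ, hθ⟩ := exists_corresponds f α
    exact ⟨θ, hθ, fun θ' hθ' => StableTriv.ext_tmul fun x T b => by
      rw [hθ'.app_tmul, hθ.app_tmul]⟩
  · intro ψ hψ f
    constructor
    · intro h
      have h' : (pullback f (centralizerBundle k l)).IsClassifyingMap l (ψ.comp f) :=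
        hψ.comp f (fun x => .refl ℂ _) (continuous_pullback_lift f _)
      obtain ⟨α⟩ := h.nonempty_iso hB (hC.pullback f) h'
      obtain ⟨θ, hθ⟩ := exists_corresponds f α
      exact ⟨θ, hθ.1⟩
    · rintro ⟨θ, hθ⟩
      obtain ⟨α, -⟩ := hθ.exists_corresponds hk hB
      exact hclass X B f α ψ hψ
  · obtain ⟨θ, hθ⟩ := exists_corresponds f
      (⟨fun x => .refl ℂ _, continuous_id, continuous_id⟩ :
        (pullback f (centralizerBundle k l)).Iso (pullback f (centralizerBundle k l)))
    exact ⟨θ, hθ.1⟩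
  · obtain ⟨α, hα⟩ := hθ.exists_corresponds hk hB
    obtain ⟨α', hα'⟩ := hθ'.exists_corresponds hk hB'
    refine ⟨α.trans α'.symm, fun x T b => ?_⟩
    rw [hα.app_tmul, hα'.app_tmul]
    congr 1
    exact congrArg centralizerVal ((α'.fiber x).apply_symm_apply (α.fiber x b))
  · rintro ⟨β, hβ⟩ x T
    have := hβ x T 1
    rw [map_one] at this
    exact this.trans (hθ x T)

end
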